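/- Let $n\ge 3$, let $F_n$ be the free group on $x_1,\dots,x_n$ with indices taken modulo $n$, and let $\mathrm{Out}(F_n)=\mathrm{Aut}(F_n)/\mathrm{Inn}(F_n)$. Let $r_i,l_i,n_i\in\mathrm{Aut}(F_n)$ be the transvections $r_i: x_{i+1}\mapsto x_{i+1}x_i$, $l_i: x_{i+1}\mapsto x_ix_{i+1}$, $n_i: x_{i+2}\mapsto x_{i+2}x_i$ (each fixing all other generators). Let $\mathcal H$ be the finite family consisting of the subgroups $\langle\phi_i,\phi_j\rangle$ with $\phi_i\in\{r_i,l_i\}$, $\phi_j\in\{r_j,l_j\}$ and $\mathrm{dist}_{\mathbb Z/n\mathbb Z}(i,j)\ge 2$, and of the subgroups $\langle r_i,l_i\rangle$, $\langle n_i,r_i\rangle$, $\langle n_i,l_{i+1}\rangle$ for all $i$; let $\overline{\mathcal H}$ be the family of their images in $\mathrm{Out}(F_n)$. Then $\mathrm{Aut}(F_n)$ and $\mathrm{Out}(F_n)$ are algebraically thick of order at most one. More precisely, they are finitely generated, every member of $\mathcal H$ and of $\overline{\mathcal H}$ is isomorphic to $\mathbb Z^2$, and for every finite generating set of $\mathrm{Aut}(F_n)$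 (respectively $\mathrm{Out}(F_n)$) there is $M>0$ such that the group, with the corresponding word metric, is $M$-algebraically thick of order at most one with respect to $\mathcal H$ (respectively $\overline{\mathcal H}$). Here a finitely generated group $G$ with a word metric is *$M$-algebraically thick of order at most one with respect to* a finite non-empty collection $\mathcal H$ of subgroups if: (0) each $H\in\mathcal H$ is finitely generated and undistorted in $G$ (word metrics of $H$ are bi-Lipschitz equivalent to the restrictions to $H$ of word metrics of $G$); (1) there is a finite index subgroup $G_1\le G$ such that every element of $G$ is at distance less than $M$ from $G_1$, and $G_1$ has a finite generating set contained in $\bigcup_{H\in\mathcal H}H$; (2) any $H,H'\in\mathcal H$ are joined by a finite sequence $H=H_1,\dots,H_k=H'$ in $\mathcal H$ with every $H_i\cap H_{i+1}$ infinite; (3) each $H\in\mathcal H$ is unconstricted: with a word metric, there are a non-principal ultrafilter $\omega$ on $\mathbb N$ and scaling constants $d_i>0$ with $\lim_\omega d_i=\infty$ such that for every sequence $b$ of observation points the asymptotic cone $\mathrm{Cone}_\omega(H,b,d)$ has no cut-point (the point of a singleton counts as a cut-point), and there is a constant $c$ such that every point of $H$ is within distance $c$ of a bi-infinite geodesic (of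 the Cayley graph). $G$ is *algebraically thick of order at most one* if this holds for some word metric on $G$, some $M>0$ and some such $\mathcal H$. -/

import Mathlib

open Filter Topology
open scoped NNReal

noncomputable section

universe u

/-! ### Word metrics -/

section WordMetric

variable {G : Type u} [Group G]

/-- The lengths of the words in `S ∪ S⁻¹` that represent `g`. -/
def wordLengths (S : Set G) (g : G) : Set ℕ :=
  {k | ∃ w : List G, (∀ x ∈ w, x ∈ S ∨ x⁻¹ ∈ S) ∧ w.prod = g ∧ w.length = k}

/-- The word length of `g` with respect to `S` (used only for generating sets `S`). -/
def wordNorm (S : Set G) (g : G) : ℕ := sInf (wordLengths S g)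

theorem wordLengths_nonempty {S : Set G} (hS : Subgroup.closure S = ⊤) (g : G) :
    (wordLengths S g).Nonempty := by
  have hg : g ∈ Subgroup.closure S := hS ▸ Subgroup.mem_top g
  rw [← Subgroup.mem_toSubmonoid, Subgroup.closure_toSubmonoid] at hg
  obtain ⟨w, hw, hp⟩ := Submonoid.exists_list_of_mem_closure hg
  exact ⟨w.length, w, hw, hp, rfl⟩

theorem exists_word {S : Set G} (hS : Subgroup.closure S = ⊤) (g : G) :
    ∃ w : List G, (∀ x ∈ w, x ∈ S ∨ x⁻¹ ∈ S) ∧ w.prod = g ∧ w.length = wordNorm S g :=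
  Nat.sInf_mem (wordLengths_nonempty hS g)

theorem wordNorm_one (S : Set G) : wordNorm S 1 = 0 :=
  Nat.sInf_eq_zero.2 (Or.inl ⟨[], by simp⟩)

theorem eq_one_of_wordNorm {S : Set G} (hS : Subgroup.closure S = ⊤) {g : G}
    (h : wordNorm S g = 0) : g = 1 := by
  obtain ⟨w, -, hp, hl⟩ := exists_word hS g
  rw [h, List.length_eq_zero_iff] at hl
  rw [← hp, hl, List.prod_nil]

theorem wordNorm_mul_le {S : Set G} (hS : Subgroup.closure S = ⊤) (g h : G) :
    wordNorm S (g * h) ≤ wordNorm S g + wordNorm S h := by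
  obtain ⟨v, hv, hvp, hvl⟩ := exists_word hS g
  obtain ⟨w, hw, hwp, hwl⟩ := exists_word hS h
  refine Nat.sInf_le ⟨v ++ w, ?_, by rw [List.prod_append, hvp, hwp], by
    rw [List.length_append, hvl, hwl]⟩
  intro x hx
  rcases List.mem_append.1 hx with hx | hx
  exacts [hv x hx, hw x hx]

theorem wordNorm_inv_le {S : Set G} (hS : Subgroup.closure S = ⊤) (g : G) :
    wordNorm S g⁻¹ ≤ wordNorm S g := by
  obtain ⟨v, hv, hvp, hvl⟩ := exists_word hS g
  refine Nat.sInf_le ⟨(v.map (fun x => x⁻¹)).reverse, ?_, ?_, by simp [hvl]⟩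
  · intro x hx
    simp only [List.mem_reverse, List.mem_map] at hx
    obtain ⟨y, hy, rfl⟩ := hx
    rw [inv_inv]
    exact (hv y hy).symm
  · rw [← hvp, List.prod_inv_reverse]

theorem wordNorm_inv {S : Set G} (hS : Subgroup.closure S = ⊤) (g : G) :
    wordNorm S g⁻¹ = wordNorm S g :=
  le_antisymm (wordNorm_inv_le hS g) (by simpa using wordNorm_inv_le hS g⁻¹)

/-- The word metric `dist g h = |g⁻¹ h|_S` of a generating set `S`. -/
@[reducible]
def wordMetricSpace (S : Set G) (hS : Subgroup.closure S = ⊤) : MetricSpace G where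
  dist g h := (wordNorm S (g⁻¹ * h) : ℝ)
  dist_self g := by simp [wordNorm_one]
  dist_comm g h := by
    rw [← wordNorm_inv hS (g⁻¹ * h)]
    simp
  dist_triangle g h k := by
    have := wordNorm_mul_le hS (g⁻¹ * h) (h⁻¹ * k)
    rw [show g⁻¹ * h * (h⁻¹ * k) = g⁻¹ * k by group] at this
    exact_mod_cast this
  eq_of_dist_eq_zero {g h} hd := by
    have h0 : wordNorm S (g⁻¹ * h) = 0 := by exact_mod_cast hd
    exact inv_mul_eq_one.1 (eq_one_of_wordNorm hS h0)

end WordMetric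

/-! ### Asymptotic cones -/

section Cone

variable {X : Type u} [MetricSpace X]

/-- Sequences in `X` at finite `ω`-distance from the observation points `b`, for the metrics
`dist / d i`. -/
def ConeSeq (ω : Ultrafilter ℕ) (b : ℕ → X) (d : ℕ → ℝ≥0) : Type u :=
  {y : ℕ → X // ∃ C : ℝ, ∀ᶠ i in (ω : Filter ℕ), dist (y i) (b i) / d i ≤ C}

variable {ω : Ultrafilter ℕ} {b : ℕ → X} {d : ℕ → ℝ≥0}

/-- The `ω`-limit of the rescaled distances; the limit exists by `ConeSeq.tendsto_dist`. -/
def ConeSeq.limDist (y z : ConeSeq ω b d) : ℝ :=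
  limUnder (ω : Filter ℕ) (fun i => dist (y.1 i) (z.1 i) / d i)

theorem ConeSeq.tendsto_dist (y z : ConeSeq ω b d) :
    Tendsto (fun i => dist (y.1 i) (z.1 i) / d i) (ω : Filter ℕ) (𝓝 (y.limDist z)) := by
  obtain ⟨C, hC⟩ := y.2
  obtain ⟨D, hD⟩ := z.2
  have hmem : ∀ᶠ i in (ω : Filter ℕ), dist (y.1 i) (z.1 i) / d i ∈ Set.Icc 0 (C + D) := by
    filter_upwards [hC, hD] with i h1 h2
    refine ⟨by positivity, ?_⟩
    calc dist (y.1 i) (z.1 i) / d i ≤ (dist (y.1 i) (b i) + dist (z.1 i) (b i)) / d i := by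
          gcongr
          exact dist_triangle_right _ _ _
      _ ≤ C + D := by rw [add_div]; exact add_le_add h1 h2
  obtain ⟨l, -, hl⟩ := (isCompact_Icc (a := (0 : ℝ)) (b := C + D)).ultrafilter_le_nhds
    (ω.map fun i => dist (y.1 i) (z.1 i) / d i) (le_principal_iff.2 hmem)
  exact tendsto_nhds_limUnder ⟨l, hl⟩

instance : PseudoMetricSpace (ConeSeq ω b d) where
  dist y z := y.limDist z
  dist_self y := by
    refine tendsto_nhds_unique (ConeSeq.tendsto_dist y y) ?_
    simp
  dist_comm y z := by
    refine tendsto_nhds_unique (ConeSeq.tendsto_dist y z) ?_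
    simpa only [dist_comm] using ConeSeq.tendsto_dist z y
  dist_triangle x y z := by
    refine le_of_tendsto_of_tendsto' (ConeSeq.tendsto_dist x z)
      ((ConeSeq.tendsto_dist x y).add (ConeSeq.tendsto_dist y z)) fun i => ?_
    rw [← add_div]
    gcongr
    exact dist_triangle _ _ _

/-- The asymptotic cone `Cone_ω(X, b, d)`: sequences at finite `ω`-distance from `b`, modulo
`ω`-distance zero. -/
abbrev AsymptoticCone (ω : Ultrafilter ℕ) (b : ℕ → X) (d : ℕ → ℝ≥0) : Type u :=
  SeparationQuotient (ConeSeq ω b d)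

end Cone

/-- `p` is a (global) cut-point if its complement is not connected. The empty set does not count as
connected, so the point of a singleton is a cut-point. -/
def IsCutPoint {Y : Type u} [TopologicalSpace Y] (p : Y) : Prop :=
  ¬ IsConnected ({p}ᶜ : Set Y)

/-- A metric space satisfies this if, for some non-principal ultrafilter and some sequence of
scaling constants, none of its asymptotic cones (for any observation points) has a cut-point. -/
def HasConesWithoutCutPoints (X : Type u) [MetricSpace X] : Prop :=
  ∃ (ω : Ultrafilter ℕ) (d : ℕ → ℝ≥0),
    (ω : Filter ℕ) ≤ cofinite ∧ (∀ i, 0 < d i) ∧ Tendsto d (ω : Filter ℕ) atTop ∧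
      ∀ b : ℕ → X, ∀ p : AsymptoticCone ω b d, ¬ IsCutPoint p

/-- Every point is at distance at most `c` from a bi-infinite geodesic. The spaces in question are
vertex sets of Cayley graphs, where bi-infinite geodesics are parametrized by the integers. -/
def NearBiinfiniteGeodesics (X : Type u) [MetricSpace X] : Prop :=
  ∃ c : ℝ, ∀ x : X, ∃ γ : ℤ → X, Isometry γ ∧ ∃ k : ℤ, dist x (γ k) ≤ c

/-- A finitely generated group is unconstricted if it is so for a word metric (the choice of the
word metric is immaterial, the notion being a quasi-isometry invariant). -/
def IsUnconstrictedGroup (G : Type u) [Group G] : Prop :=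
  ∃ (S : Set G) (hS : Subgroup.closure S = ⊤), S.Finite ∧
    letI := wordMetricSpace S hS
    HasConesWithoutCutPoints G ∧ NearBiinfiniteGeodesics G

/-! ### Algebraic networks and algebraic thickness -/

section Thick

variable {G : Type u} [Group G]

/-- A finitely generated subgroup `H` of a finitely generated group `G` is undistorted if every word
metric of `H` is bi-Lipschitz equivalent to the restriction of every word metric of `G`. -/
def IsUndistorted (H : Subgroup G) : Prop :=
  ∀ S : Set G, S.Finite → Subgroup.closure S = ⊤ →
    ∀ T : Set H, T.Finite → Subgroup.closure T = ⊤ →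
      ∃ C : ℝ, 0 < C ∧ ∀ h : H,
        (wordNorm T h : ℝ) ≤ C * wordNorm S (h : G) ∧
          (wordNorm S (h : G) : ℝ) ≤ C * wordNorm T h

/-- `H` and `K` can be joined by a finite sequence of members of `𝓗`, consecutive ones having
infinite intersection. -/
def ThicklyConnected (𝓗 : Set (Subgroup G)) (H K : Subgroup G) : Prop :=
  Relation.ReflTransGen
    (fun A B : Subgroup G => A ∈ 𝓗 ∧ B ∈ 𝓗 ∧ ((A ⊓ B : Subgroup G) : Set G).Infinite) H K

/-- `G`, with the word metric of the finite generating set `S`, is an `M`-algebraic network with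
respect to the finite collection `𝓗` of subgroups. (Asking `𝓗` to be non-empty only keeps a finite
group from being a network with respect to the empty collection.) -/
structure IsAlgebraicNetwork (S : Set G) (M : ℝ) (𝓗 : Set (Subgroup G)) : Prop where
  finite_gen : S.Finite
  closure_gen : Subgroup.closure S = ⊤
  pos : 0 < M
  finite : 𝓗.Finite
  nonempty : 𝓗.Nonempty
  undistorted : ∀ H ∈ 𝓗, H.FG ∧ IsUndistorted H
  generates : ∃ G₁ : Subgroup G, G₁.FiniteIndex ∧
    (∀ g : G, ∃ h ∈ G₁, (wordNorm S (g⁻¹ * h) : ℝ) < M) ∧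
    ∃ T : Set G, T.Finite ∧ Subgroup.closure T = G₁ ∧ T ⊆ ⋃ H ∈ 𝓗, (H : Set G)
  connected : ∀ H ∈ 𝓗, ∀ K ∈ 𝓗, ThicklyConnected 𝓗 H K

end Thick

/-- `G` is algebraically thick of order at most `n`. -/
def AlgThickOfOrderAtMost : ℕ → (G : Type u) → [Group G] → Prop
  | 0, G, _ => IsUnconstrictedGroup G
  | n + 1, G, _ => ∃ (S : Set G) (M : ℝ) (𝓗 : Set (Subgroup G)),
      IsAlgebraicNetwork S M 𝓗 ∧ ∀ H ∈ 𝓗, AlgThickOfOrderAtMost n H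

/-- `G`, with the word metric of `S`, is `M`-algebraically thick of order at most `n + 1` with
respect to `𝓗`. -/
def AlgThickSuccWithRespectTo {G : Type u} [Group G] (n : ℕ) (S : Set G) (M : ℝ)
    (𝓗 : Set (Subgroup G)) : Prop :=
  IsAlgebraicNetwork S M 𝓗 ∧ ∀ H ∈ 𝓗, AlgThickOfOrderAtMost n H

/-! ### Automorphisms of free groups -/

section Aut

variable {α : Type u} [DecidableEq α]

/-- The endomorphism `x_a ↦ u x_a v`, fixing the other generators. -/
def transvectionHom (a : α) (u v : FreeGroup α) : FreeGroup α →* FreeGroup α :=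
  FreeGroup.lift fun j => if j = a then u * FreeGroup.of a * v else FreeGroup.of j

theorem transvectionHom_of_self (a : α) (u v : FreeGroup α) :
    transvectionHom a u v (FreeGroup.of a) = u * FreeGroup.of a * v := by
  simp [transvectionHom]

theorem transvectionHom_of_ne {a j : α} (h : j ≠ a) (u v : FreeGroup α) :
    transvectionHom a u v (FreeGroup.of j) = FreeGroup.of j := by
  simp [transvectionHom, h]

theorem transvectionHom_comp {a : α} {u v u' v' : FreeGroup α}
    (hu : transvectionHom a u v u' = u') (hv : transvectionHom a u v v' = v')
    (huu : u' * u = 1) (hvv : v * v' = 1) :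
    (transvectionHom a u v).comp (transvectionHom a u' v') = MonoidHom.id _ := by
  refine FreeGroup.ext_hom _ _ fun j => ?_
  by_cases h : j = a
  · subst h
    simp only [MonoidHom.comp_apply, transvectionHom_of_self, map_mul, hu, hv, MonoidHom.id_apply]
    calc u' * (u * FreeGroup.of j * v) * v' = (u' * u) * FreeGroup.of j * (v * v') := by group
      _ = FreeGroup.of j := by rw [huu, hvv, one_mul, mul_one]
  · simp [MonoidHom.comp_apply, transvectionHom_of_ne h]

/-- For `b ≠ a`: the automorphism `x_a ↦ x_a x_b`, fixing the other generators. -/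
def rightTransvection (a b : α) (h : b ≠ a) : MulAut (FreeGroup α) :=
  MonoidHom.toMulEquiv (transvectionHom a 1 (FreeGroup.of b))
    (transvectionHom a 1 (FreeGroup.of b)⁻¹)
    (transvectionHom_comp (by simp) (by simp [transvectionHom_of_ne h]) (by simp) (by simp))
    (transvectionHom_comp (by simp) (by simp [transvectionHom_of_ne h]) (by simp) (by simp))

/-- For `b ≠ a`: the automorphism `x_a ↦ x_b x_a`, fixing the other generators. -/
def leftTransvection (a b : α) (h : b ≠ a) : MulAut (FreeGroup α) :=
  MonoidHom.toMulEquiv (transvectionHom a (FreeGroup.of b) 1)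
    (transvectionHom a (FreeGroup.of b)⁻¹ 1)
    (transvectionHom_comp (by simp [transvectionHom_of_ne h]) (by simp) (by simp) (by simp))
    (transvectionHom_comp (by simp [transvectionHom_of_ne h]) (by simp) (by simp) (by simp))

end Aut

/-- The group of inner automorphisms. -/
def Inn (G : Type u) [Group G] : Subgroup (MulAut G) := (MulAut.conj : G →* MulAut G).range

instance (G : Type u) [Group G] : (Inn G).Normal where
  conj_mem := by
    rintro _ ⟨g, rfl⟩ φ
    refine ⟨φ g, ?_⟩
    ext x
    simp [MulAut.conj_apply]

/-- The outer automorphism group `Aut(G) / Inn(G)`. -/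
abbrev Out (G : Type u) [Group G] : Type u := MulAut G ⧸ Inn G

/-- The free group of rank `n` (for `n ≥ 1`), its free generators being indexed modulo `n`. -/
abbrev FreeGrp (n : ℕ) : Type := FreeGroup (ZMod n)

section Nielsen

variable {n : ℕ}

theorem ne_add_one_zmod (hn : 3 ≤ n) (i : ZMod n) : i ≠ i + 1 := by
  have : Fact (1 < n) := ⟨by omega⟩
  simp

theorem ne_add_two_zmod (hn : 3 ≤ n) (i : ZMod n) : i ≠ i + 2 := by
  intro h
  have h2 : ((2 : ℕ) : ZMod n) = 0 := by simpa using h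
  rw [ZMod.natCast_eq_zero_iff] at h2
  have := Nat.le_of_dvd (by norm_num) h2
  omega

/-- `r_i : x_{i+1} ↦ x_{i+1} x_i`. -/
def nielsenR (hn : 3 ≤ n) (i : ZMod n) : MulAut (FreeGrp n) :=
  rightTransvection (i + 1) i (ne_add_one_zmod hn i)

/-- `l_i : x_{i+1} ↦ x_i x_{i+1}`. -/
def nielsenL (hn : 3 ≤ n) (i : ZMod n) : MulAut (FreeGrp n) :=
  leftTransvection (i + 1) i (ne_add_one_zmod hn i)

/-- `n_i : x_{i+2} ↦ x_{i+2} x_i`. -/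
def nielsenN (hn : 3 ≤ n) (i : ZMod n) : MulAut (FreeGrp n) :=
  rightTransvection (i + 2) i (ne_add_two_zmod hn i)

/-- The distance of `i` and `j` in the cyclic group `ℤ / n`. -/
def cyclicDist (i j : ZMod n) : ℕ := (i - j).valMinAbs.natAbs

/-- The family of subgroups `⟨φ_i, φ_j⟩` with `φ_i ∈ {r_i, l_i}`, `φ_j ∈ {r_j, l_j}` and
`dist(i, j) ≥ 2`, together with `⟨r_i, l_i⟩`, `⟨n_i, r_i⟩` and `⟨n_i, l_{i+1}⟩`. -/
def nielsenFamily (hn : 3 ≤ n) : Set (Subgroup (MulAut (FreeGrp n))) :=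
  {H | ∃ i j : ZMod n, 2 ≤ cyclicDist i j ∧
      ∃ φ ∈ ({nielsenR hn i, nielsenL hn i} : Set (MulAut (FreeGrp n))),
      ∃ ψ ∈ ({nielsenR hn j, nielsenL hn j} : Set (MulAut (FreeGrp n))),
        H = Subgroup.closure {φ, ψ}} ∪
  {H | ∃ i : ZMod n, H = Subgroup.closure {nielsenR hn i, nielsenL hn i}} ∪
  {H | ∃ i : ZMod n, H = Subgroup.closure {nielsenN hn i, nielsenR hn i}} ∪
  {H | ∃ i : ZMod n, H = Subgroup.closure {nielsenN hn i, nielsenL hn (i + 1)}}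

/-- The images in `Out(F_n)` of the members of `nielsenFamily`. -/
def outNielsenFamily (hn : 3 ≤ n) : Set (Subgroup (Out (FreeGrp n))) :=
  Subgroup.map (QuotientGroup.mk' (Inn (FreeGrp n))) '' nielsenFamily hn

end Nielsen

end

/-!
By Nielsen reduction (moves `x ↦ v⁻¹ x` on the images of the generators that lower a well-founded
complexity) the elementary moves, together with the finitely many automorphisms permuting the
generators up to inversion, generate `Aut(F_n)`; all elementary moves are iterated commutators of
the `r_i` and `l_i`, so these generate a subgroup of finite index.

The generators of a subgroup in the family are commuting moves `φ`, `ψ`, and there is a word `w`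
such that every conjugate of `(φ ^ a * ψ ^ b) w` contains a power with exponent about
`max |a| |b| / 2`. By bounded cancellation, an automorphism lowers the exponents of the powers
occurring in a word by at most a constant, so `φ ^ a * ψ ^ b` has word norm at least linear in
`|a| + |b|`. As conjugates are allowed, this holds even in `Out(F_n)`, and the subgroup is an
undistorted `ℤ²`. It is unconstricted because its asymptotic cones are planes with the `ℓ¹` metric.

Finally `⟨r_i, l_i⟩`, `⟨n_i, r_i⟩`, `⟨n_i, l_{i+1}⟩`, `⟨r_{i+1}, l_{i+1}⟩` is a chain whose
consecutive members share a generator, and so have infinite intersection.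
-/

/-! ### Common prefixes in free groups -/

section CommonPrefix

open FreeGroup (mk invRev)

variable {α : Type*}

/-- The formal inverse of a letter. -/
def invLetter (l : α × Bool) : α × Bool := (l.1, !l.2)

theorem invLetter_invLetter (l : α × Bool) : invLetter (invLetter l) = l := by
  simp [invLetter]

theorem invLetter_ne (l : α × Bool) : invLetter l ≠ l := by
  simp [invLetter, Prod.ext_iff]

theorem eq_or_eq_invLetter {a b : α × Bool} (h : a.1 = b.1) : a = b ∨ a = invLetter b := by
  rcases a with ⟨i, _ | _⟩ <;> rcases b with ⟨j, _ | _⟩ <;> simp_all [invLetter]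

theorem fst_eq_imp_snd_eq_iff {a b : α × Bool} : (a.1 = b.1 → a.2 = b.2) ↔ a ≠ invLetter b := by
  rcases a with ⟨i, _ | _⟩ <;> rcases b with ⟨j, _ | _⟩ <;> simp [invLetter]

theorem invRev_cons_eq_append (l : α × Bool) (w : List (α × Bool)) :
    invRev (l :: w) = invRev w ++ [invLetter l] := by
  simp [invRev, invLetter]

theorem mk_invLetter (l : α × Bool) : mk [invLetter l] = (mk [l])⁻¹ := by
  simp [FreeGroup.inv_mk, invRev, invLetter]

theorem mk_cons (l : α × Bool) (w : List (α × Bool)) : mk (l :: w) = mk [l] * mk w := by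
  rw [FreeGroup.mul_mk, List.singleton_append]

theorem isReduced_cons_cons_iff_ne {a b : α × Bool} {w : List (α × Bool)} :
    FreeGroup.IsReduced (a :: b :: w) ↔ a ≠ invLetter b ∧ FreeGroup.IsReduced (b :: w) := by
  rw [FreeGroup.isReduced_cons_cons, fst_eq_imp_snd_eq_iff]

theorem isReduced_append_iff {v w : List (α × Bool)} :
    FreeGroup.IsReduced (v ++ w) ↔ FreeGroup.IsReduced v ∧ FreeGroup.IsReduced w ∧
      ∀ a ∈ v.getLast?, ∀ b ∈ w.head?, a ≠ invLetter b := by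
  simp only [FreeGroup.IsReduced, List.isChain_append, fst_eq_imp_snd_eq_iff]

theorem isReduced_invRev {w : List (α × Bool)} (h : FreeGroup.IsReduced w) :
    FreeGroup.IsReduced (invRev w) := by
  classical
  rw [FreeGroup.isReduced_iff_reduce_eq] at h ⊢
  rw [FreeGroup.reduce_invRev, h]

theorem exists_commonPrefix {v w : List (α × Bool)} (hv : FreeGroup.IsReduced v)
    (hw : FreeGroup.IsReduced w) :
    ∃ p s t, v = p ++ s ∧ w = p ++ t ∧ FreeGroup.IsReduced (invRev s ++ t) := by
  classical
  induction v generalizing w with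
  | nil => exact ⟨[], [], w, rfl, rfl, hw⟩
  | cons a v ih =>
    rcases w with _ | ⟨b, w⟩
    · exact ⟨[], a :: v, [], rfl, rfl, by simpa only [List.append_nil] using isReduced_invRev hv⟩
    by_cases hab : a = b
    · subst hab
      obtain ⟨p, s, t, rfl, rfl, h⟩ :=
        ih (hv.infix (List.infix_cons List.infix_rfl)) (hw.infix (List.infix_cons List.infix_rfl))
      exact ⟨a :: p, s, t, rfl, rfl, h⟩
    · refine ⟨[], a :: v, b :: w, rfl, rfl, isReduced_append_iff.2 ⟨isReduced_invRev hv, hw, ?_⟩⟩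
      intro x hx y hy
      simp only [invRev_cons_eq_append, List.getLast?_append, List.getLast?_singleton,
        Option.some_or, Option.mem_some_iff, List.head?_cons] at hx hy
      subst hx hy
      exact fun h => hab (by simpa only [invLetter_invLetter] using congrArg invLetter h)

variable [DecidableEq α]

/-- The Gromov product of two elements of a free group, based at `1` in the Cayley tree. It is the
length of the longest common prefix of their reduced words, so both subtraction and division are
exact (`norm_inv_mul_add`). -/
def gromovProduct (u v : FreeGroup α) : ℕ := (u.norm + v.norm - (u⁻¹ * v).norm) / 2

theorem toWord_mk_of_isReduced {w : List (α × Bool)} (h : FreeGroup.IsReduced w) :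
    (mk w).toWord = w := by
  rw [FreeGroup.toWord_mk, h.reduce_eq]

theorem norm_mk_of_isReduced {w : List (α × Bool)} (h : FreeGroup.IsReduced w) :
    (mk w).norm = w.length := by
  rw [FreeGroup.norm, toWord_mk_of_isReduced h]

theorem exists_toWord_eq_append (u v : FreeGroup α) :
    ∃ p s t, u.toWord = p ++ s ∧ v.toWord = p ++ t ∧ (u⁻¹ * v).toWord = invRev s ++ t ∧
      p.length = gromovProduct u v := by
  obtain ⟨p, s, t, hu, hv, h⟩ :=
    exists_commonPrefix (FreeGroup.isReduced_toWord (x := u)) (FreeGroup.isReduced_toWord (x := v))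
  have huv : (u⁻¹ * v).toWord = invRev s ++ t := by
    rw [← toWord_mk_of_isReduced h, FreeGroup.toWord_inj, ← FreeGroup.mk_toWord (x := u),
      ← FreeGroup.mk_toWord (x := v), hu, hv]
    simp only [← FreeGroup.mul_mk, ← FreeGroup.inv_mk]
    group
  refine ⟨p, s, t, hu, hv, huv, ?_⟩
  simp only [gromovProduct, FreeGroup.norm, hu, hv, huv, List.length_append,
    FreeGroup.invRev_length]
  lia

theorem norm_inv_mul_add (u v : FreeGroup α) :
    (u⁻¹ * v).norm + 2 * gromovProduct u v = u.norm + v.norm := by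
  obtain ⟨p, s, t, hu, hv, huv, hp⟩ := exists_toWord_eq_append u v
  simp only [← hp, FreeGroup.norm, hu, hv, huv, List.length_append, FreeGroup.invRev_length]
  lia

theorem gromovProduct_comm (u v : FreeGroup α) : gromovProduct u v = gromovProduct v u := by
  have huv := norm_inv_mul_add u v
  have hvu := norm_inv_mul_add v u
  rw [← FreeGroup.norm_inv_eq, mul_inv_rev, inv_inv] at hvu
  lia

theorem gromovProduct_le_left (u v : FreeGroup α) : gromovProduct u v ≤ u.norm := by
  obtain ⟨p, s, t, hu, -, -, hp⟩ := exists_toWord_eq_append u v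
  simp [← hp, FreeGroup.norm, hu]

theorem gromovProduct_le_right (u v : FreeGroup α) : gromovProduct u v ≤ v.norm := by
  rw [gromovProduct_comm]
  exact gromovProduct_le_left v u

theorem gromovProduct_mul_left_add (u v : FreeGroup α) :
    gromovProduct (u * v) u + gromovProduct u⁻¹ v = u.norm := by
  have hu := norm_inv_mul_add u⁻¹ v
  have huv := norm_inv_mul_add (u * v) u
  rw [inv_inv, FreeGroup.norm_inv_eq] at hu
  rw [show (u * v)⁻¹ * u = v⁻¹ by group, FreeGroup.norm_inv_eq] at huv
  lia

theorem le_gromovProduct_iff {u v : FreeGroup α} {m : ℕ} :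
    m ≤ gromovProduct u v ↔ m ≤ u.norm ∧ m ≤ v.norm ∧ u.toWord.take m = v.toWord.take m := by
  obtain ⟨p, s, t, hu, hv, huv, hp⟩ := exists_toWord_eq_append u v
  constructor
  · intro h
    refine ⟨h.trans (gromovProduct_le_left u v), h.trans (gromovProduct_le_right u v), ?_⟩
    rw [hu, hv, List.take_append_of_le_length (by lia), List.take_append_of_le_length (by lia)]
  · rintro ⟨hmu, hmv, htake⟩
    by_contra! hm
    rw [← hp] at hm
    simp only [FreeGroup.norm, hu, hv, List.length_append] at hmu hmv
    rw [hu, hv, List.take_append, List.take_append, List.take_of_length_le hm.le,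
      List.append_cancel_left_eq] at htake
    obtain ⟨a, s, rfl⟩ := List.exists_cons_of_length_pos (show 0 < s.length by lia)
    obtain ⟨b, t, rfl⟩ := List.exists_cons_of_length_pos (show 0 < t.length by lia)
    obtain ⟨k, hk⟩ : ∃ k, m - p.length = k + 1 := ⟨m - p.length - 1, by lia⟩
    rw [hk, List.take_succ_cons, List.take_succ_cons, List.cons.injEq] at htake
    have hred : FreeGroup.IsReduced (invRev (a :: s) ++ b :: t) := huv ▸ FreeGroup.isReduced_toWord
    rw [isReduced_append_iff, invRev_cons_eq_append] at hred
    exact hred.2.2 (invLetter a) (by simp) b (by simp) (by rw [htake.1])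

theorem gromovProduct_self (u : FreeGroup α) : gromovProduct u u = u.norm :=
  le_antisymm (gromovProduct_le_left u u) (le_gromovProduct_iff.2 ⟨le_rfl, le_rfl, rfl⟩)

theorem min_gromovProduct_le (u v w : FreeGroup α) :
    min (gromovProduct u v) (gromovProduct v w) ≤ gromovProduct u w := by
  obtain ⟨hu, -, huv⟩ := le_gromovProduct_iff.1 (min_le_left (gromovProduct u v) _)
  obtain ⟨-, hw, hvw⟩ := le_gromovProduct_iff.1 (min_le_right _ (gromovProduct v w))
  exact le_gromovProduct_iff.2 ⟨hu, hw, huv.trans hvw⟩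

theorem gromovProduct_eq_of_lt {u v w : FreeGroup α} (h : gromovProduct u v < gromovProduct w v) :
    gromovProduct u w = gromovProduct u v := by
  have huvw := min_gromovProduct_le u v w
  have huwv := min_gromovProduct_le u w v
  rw [gromovProduct_comm v w] at huvw
  lia

theorem toWord_eq_conj (g : FreeGroup α) :
    g.toWord = FreeGroup.reduceCyclically.conjugator g.toWord ++
      FreeGroup.reduceCyclically g.toWord ++
        invRev (FreeGroup.reduceCyclically.conjugator g.toWord) :=
  (FreeGroup.reduceCyclically.conj_conjugator_reduceCyclically _).symm

theorem toWord_pow_succ (g : FreeGroup α) (k : ℕ) :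
    (g ^ (k + 1)).toWord = FreeGroup.reduceCyclically.conjugator g.toWord ++
      (List.replicate (k + 1) (FreeGroup.reduceCyclically g.toWord)).flatten ++
        invRev (FreeGroup.reduceCyclically.conjugator g.toWord) := by
  rw [FreeGroup.toWord_pow,
    FreeGroup.reduceCyclically.reduce_flatten_replicate_succ FreeGroup.isReduced_toWord]

theorem reduceCyclically_toWord_ne_nil {g : FreeGroup α} (hg : g ≠ 1) :
    FreeGroup.reduceCyclically g.toWord ≠ [] := by
  intro h
  have hconj := toWord_eq_conj g
  rw [h, List.append_nil] at hconj
  rw [← FreeGroup.mk_toWord (x := g), hconj, ← FreeGroup.mul_mk, ← FreeGroup.inv_mk,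
    mul_inv_cancel] at hg
  exact hg rfl

theorem two_mul_gromovProduct_inv_lt {g : FreeGroup α} (hg : g ≠ 1) :
    2 * gromovProduct g⁻¹ g < g.norm := by
  have hsq := norm_inv_mul_add g⁻¹ g
  have hlen := congrArg List.length (toWord_eq_conj g)
  have hlen_sq := congrArg List.length (toWord_pow_succ g 1)
  have hpos := List.length_pos_of_ne_nil (reduceCyclically_toWord_ne_nil hg)
  rw [inv_inv, FreeGroup.norm_inv_eq, ← pow_two] at hsq
  simp only [List.length_append, FreeGroup.invRev_length, List.length_flatten, List.map_replicate,
    List.sum_replicate, smul_eq_mul, Nat.reduceAdd] at hlen hlen_sq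
  simp only [FreeGroup.norm] at hsq ⊢
  lia

end CommonPrefix

/-! ### Nielsen reduction -/

section NielsenReduced

open FreeGroup (mk of)

variable {α β F : Type*} [DecidableEq β] [FunLike F (FreeGroup α) (FreeGroup β)]

/-- The images under `φ` of the free generators form a Nielsen reduced family: no letter loses more
than half of its image to a neighbour in a reduced word, and none loses all of its image to its
two neighbours together. -/
structure IsNielsenReduced (φ : F) : Prop where
  intro ::
  two_mul_gromovProduct_le : ∀ a b : α × Bool, a ≠ b →
    2 * gromovProduct (φ (mk [a])) (φ (mk [b])) ≤ (φ (mk [a])).norm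
  gromovProduct_add_lt : ∀ a v b : α × Bool, a ≠ v → b ≠ invLetter v →
    gromovProduct (φ (mk [a])) (φ (mk [v])) + gromovProduct (φ (mk [invLetter v])) (φ (mk [b])) <
      (φ (mk [v])).norm

variable {φ : F}

theorem IsNielsenReduced.norm_apply_letter_pos (h : IsNielsenReduced φ) (l : α × Bool) :
    0 < (φ (mk [l])).norm :=
  pos_of_gt (h.gromovProduct_add_lt (invLetter l) l l (invLetter_ne l) (invLetter_ne l).symm)

variable [MonoidHomClass F (FreeGroup α) (FreeGroup β)]

theorem IsNielsenReduced.gromovProduct_lt (h : IsNielsenReduced φ) {l m : α × Bool}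
    {w : List (α × Bool)} (hw : FreeGroup.IsReduced (l :: m :: w)) :
    gromovProduct (φ (mk [invLetter l])) (φ (mk [m])) <
      gromovProduct (φ (mk (m :: w))) (φ (mk [m])) := by
  induction w generalizing l m with
  | nil =>
    have hne : m ≠ invLetter l := by
      rintro rfl
      exact (isReduced_cons_cons_iff_ne.1 hw).1 (invLetter_invLetter l).symm
    have hle := h.two_mul_gromovProduct_le _ _ hne
    have hpos := h.norm_apply_letter_pos m
    rw [gromovProduct_self, gromovProduct_comm]
    lia
  | cons k w ih =>
    obtain ⟨hlm, hmkw⟩ := isReduced_cons_cons_iff_ne.1 hw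
    have hmk := (isReduced_cons_cons_iff_ne.1 hmkw).1
    have hcancel : gromovProduct (φ (mk [invLetter m])) (φ (mk (k :: w))) =
        gromovProduct (φ (mk [invLetter m])) (φ (mk [k])) := gromovProduct_eq_of_lt (ih hmkw)
    have hlt := h.gromovProduct_add_lt (invLetter l) m k
      (fun h => hlm (by rw [← h, invLetter_invLetter]))
      (fun h => hmk (by rw [h, invLetter_invLetter]))
    have hsplit := gromovProduct_mul_left_add (φ (mk [m])) (φ (mk (k :: w)))
    rw [← map_inv, ← map_mul, ← mk_cons, ← mk_invLetter] at hsplit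
    lia

theorem IsNielsenReduced.length_add_gromovProduct_le (h : IsNielsenReduced φ) {l : α × Bool}
    {w : List (α × Bool)} (hw : FreeGroup.IsReduced (l :: w)) :
    w.length + gromovProduct (φ (mk (l :: w))) (φ (mk [l])) ≤ (φ (mk (l :: w))).norm := by
  induction w generalizing l with
  | nil => simp [gromovProduct_self]
  | cons m w ih =>
    have hlt := h.gromovProduct_lt hw
    have hle := ih (isReduced_cons_cons_iff_ne.1 hw).2
    have hcancel := gromovProduct_eq_of_lt hlt
    have hsplit := gromovProduct_mul_left_add (φ (mk [l])) (φ (mk (m :: w)))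
    have hnorm := norm_inv_mul_add (φ (mk [l]))⁻¹ (φ (mk (m :: w)))
    rw [inv_inv, FreeGroup.norm_inv_eq, ← map_inv, ← map_mul, ← mk_cons, ← mk_invLetter] at hnorm
    rw [← map_inv, ← map_mul, ← mk_cons, ← mk_invLetter] at hsplit
    rw [List.length_cons]
    lia

theorem IsNielsenReduced.length_le_norm (h : IsNielsenReduced φ) {w : List (α × Bool)}
    (hw : FreeGroup.IsReduced w) : w.length ≤ (φ (mk w)).norm := by
  rcases w with _ | ⟨l, w⟩
  · exact Nat.zero_le _
  have hle := h.length_add_gromovProduct_le hw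
  have hpos := h.gromovProduct_lt
    (isReduced_cons_cons_iff_ne.2 ⟨(invLetter_ne l).symm, hw⟩)
  rw [List.length_cons]
  lia

end NielsenReduced

section SignedPerms

open FreeGroup (mk of)

/-- The automorphisms that map each free generator to a free generator or its inverse. -/
def signedPerms (α : Type*) : Set (MulAut (FreeGroup α)) :=
  {φ | ∀ i, ∃ l : α × Bool, φ (of i) = mk [l]}

theorem finite_signedPerms (α : Type*) [Finite α] : (signedPerms α).Finite := by
  refine Set.Finite.of_finite_image (f := fun φ i => φ (of i)) ?_ fun φ _ ψ _ h =>
    MulEquiv.toMonoidHom_injective (FreeGroup.ext_hom _ _ (congrFun h))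
  refine (Set.finite_range fun f : α → α × Bool => fun i => mk [f i]).subset ?_
  rintro _ ⟨φ, hφ, rfl⟩
  choose f hf using hφ
  exact ⟨f, funext fun i => (hf i).symm⟩

theorem IsNielsenReduced.inv_mem_signedPerms {α : Type*} [DecidableEq α] {φ : MulAut (FreeGroup α)}
    (h : IsNielsenReduced φ) : φ⁻¹ ∈ signedPerms α := by
  intro i
  have hle := h.length_le_norm (FreeGroup.isReduced_toWord (x := φ⁻¹ (of i)))
  rw [FreeGroup.mk_toWord, MulAut.apply_inv_self, FreeGroup.norm_of] at hle
  have hne : (φ⁻¹ (of i)).toWord ≠ [] := by simp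
  obtain ⟨l, hl⟩ := List.length_eq_one_iff.1 (le_antisymm hle (List.length_pos_of_ne_nil hne))
  exact ⟨l, by rw [← hl, FreeGroup.mk_toWord]⟩

end SignedPerms

section MinimalComplexity

open FreeGroup (mk of)

section ElementComplexity

variable {α : Type*}

section HalfWord

variable [DecidableEq α]

/-- The first half of the reduced word of `u`, without the middle letter if its length is odd. -/
def halfWord (u : FreeGroup α) : List (α × Bool) := u.toWord.take (u.norm / 2)

theorem length_halfWord (u : FreeGroup α) : (halfWord u).length = u.norm / 2 := by
  rw [halfWord, List.length_take]
  exact min_eq_left (Nat.div_le_self _ _)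

theorem halfWord_eq_append {u : FreeGroup α} {p t : List (α × Bool)} (hu : u.toWord = p ++ t)
    (hpt : p.length ≤ t.length) : halfWord u = p ++ t.take (u.norm / 2 - p.length) := by
  have hnorm : u.norm = p.length + t.length := by rw [FreeGroup.norm, hu, List.length_append]
  rw [halfWord, hu, List.take_append, List.take_of_length_le (by lia)]

theorem halfWord_inv_eq_take {u : FreeGroup α} {p t : List (α × Bool)} (hu : u.toWord = p ++ t)
    (hpt : p.length ≤ t.length) : halfWord u⁻¹ = (FreeGroup.invRev t).take (u.norm / 2) := by
  have hnorm : u.norm = p.length + t.length := by rw [FreeGroup.norm, hu, List.length_append]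
  rw [halfWord, FreeGroup.norm_inv_eq, FreeGroup.toWord_inv, hu, FreeGroup.invRev_append,
    List.take_append_of_le_length (by rw [FreeGroup.invRev_length]; lia)]

end HalfWord

variable [Finite α]

/-- A numbering of words, injective on the words of a given length (`wordCode_inj`): the letters are
the digits, the first one the least significant. -/
noncomputable def wordCode (w : List (α × Bool)) : ℕ :=
  Nat.ofDigits (Nat.card (α × Bool) + 2) (w.map fun l => (Finite.equivFin (α × Bool) l : ℕ))

theorem wordCode_append (v w : List (α × Bool)) :
    wordCode (v ++ w) = wordCode v + (Nat.card (α × Bool) + 2) ^ v.length * wordCode w := by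
  simp [wordCode, Nat.ofDigits_append]

theorem wordCode_inj {v w : List (α × Bool)} (hlen : v.length = w.length)
    (h : wordCode v = wordCode w) : v = w := by
  have digit_lt (u : List (α × Bool)) :
      ∀ d ∈ u.map fun l => (Finite.equivFin (α × Bool) l : ℕ), d < Nat.card (α × Bool) + 2 := by
    intro d hd
    obtain ⟨l, -, rfl⟩ := List.mem_map.1 hd
    exact (Fin.is_lt _).trans (by lia)
  refine List.map_injective_iff.2 (fun x y hxy => (Finite.equivFin _).injective (Fin.ext hxy))
    (Nat.ofDigits_inj_of_len_eq (by lia) ?_ (digit_lt v) (digit_lt w) h)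
  simpa only [List.length_map] using hlen

variable [DecidableEq α]

/-- The complexity that Nielsen reduction decreases: the length of `u`, and among elements of the
same length the codes of the two halves of `u`, both read towards the middle. -/
noncomputable def elementComplexity (u : FreeGroup α) : ℕ ×ₗ ℕ :=
  toLex (u.norm, wordCode (halfWord u) + wordCode (halfWord u⁻¹))

theorem elementComplexity_inv (u : FreeGroup α) : elementComplexity u⁻¹ = elementComplexity u := by
  rw [elementComplexity, elementComplexity, FreeGroup.norm_inv_eq, inv_inv, add_comm]

theorem elementComplexity_lt_of_norm_lt {u v : FreeGroup α} (h : u.norm < v.norm) :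
    elementComplexity u < elementComplexity v :=
  Prod.Lex.toLex_lt_toLex.2 (Or.inl h)

theorem elementComplexity_lt_of_wordCode_lt {u v : FreeGroup α} {p q t : List (α × Bool)}
    (hu : u.toWord = q ++ t) (hv : v.toWord = p ++ t) (hpq : p.length = q.length)
    (hpt : p.length ≤ t.length) (hlt : wordCode q < wordCode p) :
    elementComplexity u < elementComplexity v := by
  have hnorm : u.norm = v.norm := by simp only [FreeGroup.norm, hu, hv, hpq, List.length_append]
  refine Prod.Lex.toLex_lt_toLex.2 (Or.inr ⟨hnorm, ?_⟩)
  dsimp only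
  rw [halfWord_eq_append hu (hpq ▸ hpt), halfWord_eq_append hv hpt,
    halfWord_inv_eq_take hu (hpq ▸ hpt), halfWord_inv_eq_take hv hpt, wordCode_append,
    wordCode_append, hnorm, hpq]
  lia

end ElementComplexity

section MinimalImage

variable {α β F : Type*} [DecidableEq β] [FunLike F (FreeGroup α) (FreeGroup β)] {φ : F}

theorem mk_singleton_ne_one (l : α × Bool) : mk [l] ≠ 1 := by
  classical
  rw [Ne, ← FreeGroup.norm_eq_zero, norm_mk_of_isReduced FreeGroup.IsReduced.singleton]
  exact one_ne_zero

variable [MonoidHomClass F (FreeGroup α) (FreeGroup β)]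

theorem two_mul_gromovProduct_apply_invLetter_lt (hφ : Function.Injective φ) (l : α × Bool) :
    2 * gromovProduct (φ (mk [invLetter l])) (φ (mk [l])) < (φ (mk [l])).norm := by
  rw [mk_invLetter, map_inv]
  exact two_mul_gromovProduct_inv_lt ((map_ne_one_iff φ hφ).2 (mk_singleton_ne_one l))

theorem norm_apply_invLetter (φ : F) (l : α × Bool) :
    (φ (mk [invLetter l])).norm = (φ (mk [l])).norm := by
  rw [mk_invLetter, map_inv, FreeGroup.norm_inv_eq]

variable [Finite β]

theorem two_mul_gromovProduct_le_of_elementComplexity_le (hφ : Function.Injective φ)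
    (hmin : ∀ a v : α × Bool, a.1 ≠ v.1 →
      elementComplexity (φ (mk [a])) ≤ elementComplexity ((φ (mk [v]))⁻¹ * φ (mk [a])))
    {a b : α × Bool} (hab : a ≠ b) :
    2 * gromovProduct (φ (mk [a])) (φ (mk [b])) ≤ (φ (mk [b])).norm := by
  by_cases hfst : a.1 = b.1
  · obtain rfl := (eq_or_eq_invLetter hfst).resolve_left hab
    exact (two_mul_gromovProduct_apply_invLetter_lt hφ b).le
  by_contra! hlt
  refine (hmin a b hfst).not_gt (elementComplexity_lt_of_norm_lt ?_)
  have hnorm := norm_inv_mul_add (φ (mk [b])) (φ (mk [a]))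
  rw [gromovProduct_comm] at hnorm
  lia

theorem wordCode_halfWord_le_of_elementComplexity_le (hφ : Function.Injective φ)
    (hmin : ∀ a v : α × Bool, a.1 ≠ v.1 →
      elementComplexity (φ (mk [a])) ≤ elementComplexity ((φ (mk [v]))⁻¹ * φ (mk [a])))
    {a v : α × Bool} (hav : a ≠ v)
    (heq : 2 * gromovProduct (φ (mk [a])) (φ (mk [v])) = (φ (mk [v])).norm) :
    wordCode (halfWord (φ (mk [v]))) ≤ wordCode (halfWord (φ (mk [v]))⁻¹) := by
  have hfst : a.1 ≠ v.1 := by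
    intro hfst
    obtain rfl := (eq_or_eq_invLetter hfst).resolve_left hav
    exact (two_mul_gromovProduct_apply_invLetter_lt hφ v).ne heq
  have hle := two_mul_gromovProduct_le_of_elementComplexity_le hφ hmin hav.symm
  rw [gromovProduct_comm] at heq
  obtain ⟨p, s, t, hv, ha, hva, hp⟩ := exists_toWord_eq_append (φ (mk [v])) (φ (mk [a]))
  have hv_norm : (φ (mk [v])).norm = p.length + s.length := by simp [FreeGroup.norm, hv]
  have ha_norm : (φ (mk [a])).norm = p.length + t.length := by simp [FreeGroup.norm, ha]
  have hv_half : halfWord (φ (mk [v])) = p := by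
    rw [halfWord_eq_append hv (by lia), Nat.sub_eq_zero_of_le (by lia), List.take_zero,
      List.append_nil]
  have hv_inv_half : halfWord (φ (mk [v]))⁻¹ = FreeGroup.invRev s := by
    rw [halfWord_inv_eq_take hv (by lia), List.take_of_length_le]
    rw [FreeGroup.invRev_length]
    lia
  rw [hv_half, hv_inv_half]
  by_contra! hlt
  exact (hmin a v hfst).not_gt (elementComplexity_lt_of_wordCode_lt hva ha
    (by rw [FreeGroup.invRev_length]; lia) (by lia) hlt)

theorem isNielsenReduced_of_elementComplexity_le (hφ : Function.Injective φ)
    (hmin : ∀ a v : α × Bool, a.1 ≠ v.1 →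
      elementComplexity (φ (mk [a])) ≤ elementComplexity ((φ (mk [v]))⁻¹ * φ (mk [a]))) :
    IsNielsenReduced φ where
  two_mul_gromovProduct_le a b hab := by
    rw [gromovProduct_comm]
    exact two_mul_gromovProduct_le_of_elementComplexity_le hφ hmin hab.symm
  gromovProduct_add_lt a v b hav hbv := by
    by_contra! hle
    have hav_le := two_mul_gromovProduct_le_of_elementComplexity_le hφ hmin hav
    have hbv_le := two_mul_gromovProduct_le_of_elementComplexity_le hφ hmin hbv
    have hnorm := norm_apply_invLetter φ v
    rw [gromovProduct_comm (φ (mk [invLetter v]))] at hle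
    have hcode := wordCode_halfWord_le_of_elementComplexity_le hφ hmin hav (by lia)
    have hcode_inv := wordCode_halfWord_le_of_elementComplexity_le hφ hmin hbv (by lia)
    rw [mk_invLetter, map_inv, inv_inv] at hcode_inv
    have hhalf : halfWord (φ (mk [v]))⁻¹ = halfWord (φ (mk [v])) :=
      wordCode_inj (by rw [length_halfWord, length_halfWord, FreeGroup.norm_inv_eq])
        (le_antisymm hcode_inv hcode)
    have hlong : (φ (mk [v])).norm / 2 ≤ gromovProduct (φ (mk [v]))⁻¹ (φ (mk [v])) := by
      refine le_gromovProduct_iff.2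
        ⟨by rw [FreeGroup.norm_inv_eq]; lia, Nat.div_le_self _ _, ?_⟩
      rwa [halfWord, halfWord, FreeGroup.norm_inv_eq] at hhalf
    have hshort := two_mul_gromovProduct_apply_invLetter_lt hφ v
    rw [mk_invLetter, map_inv] at hshort
    lia

end MinimalImage

section ElementaryMove

variable {α : Type*} {τ : MulAut (FreeGroup α)} {a v : α × Bool}

/-- `τ` replaces the letter `a` by `v⁻¹ a` and fixes the other generators; `v` is meant to be a
letter other than `a` and `a⁻¹`. -/
def IsElementaryMove (τ : MulAut (FreeGroup α)) (a v : α × Bool) : Prop :=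
  τ (mk [a]) = (mk [v])⁻¹ * mk [a] ∧ ∀ i, i ≠ a.1 → τ (of i) = of i

theorem mk_singleton_eq_or (l : α × Bool) : mk [l] = of l.1 ∨ mk [l] = (of l.1)⁻¹ := by
  rcases l with ⟨i, _ | _⟩
  exacts [Or.inr (mk_invLetter (i, true)), Or.inl rfl]

theorem IsElementaryMove.apply_letter_of_ne {l : α × Bool} (h : IsElementaryMove τ a v)
    (hl : l.1 ≠ a.1) : τ (mk [l]) = mk [l] := by
  rcases mk_singleton_eq_or l with hl' | hl' <;> rw [hl']
  · exact h.2 _ hl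
  · rw [map_inv, h.2 _ hl]

theorem IsElementaryMove.apply_invLetter (h : IsElementaryMove τ a v) :
    τ (mk [invLetter a]) = mk [invLetter a] * mk [v] := by
  rw [mk_invLetter, map_inv, h.1, mul_inv_rev, inv_inv]

theorem elementComplexity_apply_fst [DecidableEq α] [Finite α]
    (φ : MulAut (FreeGroup α)) (l : α × Bool) :
    elementComplexity (φ (of l.1)) = elementComplexity (φ (mk [l])) := by
  rcases mk_singleton_eq_or l with hl | hl <;> rw [hl]
  rw [map_inv, elementComplexity_inv]

variable [DecidableEq α] [Fintype α]

/-- The total complexity of the images of the free generators. -/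
noncomputable def complexity (φ : MulAut (FreeGroup α)) : ℕ ×ₗ ℕ :=
  ∑ i, elementComplexity (φ (of i))

theorem IsElementaryMove.complexity_mul_lt (hτ : IsElementaryMove τ a v) {φ : MulAut (FreeGroup α)}
    (h : elementComplexity ((φ (mk [v]))⁻¹ * φ (mk [a])) < elementComplexity (φ (mk [a]))) :
    complexity (φ * τ) < complexity φ := by
  have hlt : elementComplexity ((φ * τ) (of a.1)) < elementComplexity (φ (of a.1)) := by
    rwa [elementComplexity_apply_fst, elementComplexity_apply_fst, MulAut.mul_apply, hτ.1,
      map_mul, map_inv]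
  refine Finset.sum_lt_sum (fun i _ => ?_) ⟨a.1, Finset.mem_univ _, hlt⟩
  by_cases hi : i = a.1
  · exact hi ▸ hlt.le
  · rw [MulAut.mul_apply, hτ.2 i hi]

end ElementaryMove

theorem exists_mul_mem_signedPerms {α : Type*} [Finite α]
    {K : Subgroup (MulAut (FreeGroup α))}
    (hK : ∀ a v : α × Bool, a.1 ≠ v.1 → ∃ τ ∈ K, IsElementaryMove τ a v)
    (φ : MulAut (FreeGroup α)) : ∃ τ ∈ K, ∃ σ ∈ signedPerms α, φ = τ * σ := by
  classical
  cases nonempty_fintype α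
  obtain ⟨τ, hτ, hmin⟩ := (InvImage.wf (fun τ => complexity (φ⁻¹ * τ)) wellFounded_lt).has_min
    (K : Set (MulAut (FreeGroup α))) ⟨1, K.one_mem⟩
  have hred : IsNielsenReduced (φ⁻¹ * τ) := by
    refine isNielsenReduced_of_elementComplexity_le (EquivLike.injective _) fun a v hav => ?_
    by_contra! hlt
    obtain ⟨ρ, hρ, hmove⟩ := hK a v hav
    refine hmin (τ * ρ) (K.mul_mem hτ hρ) ?_
    have := hmove.complexity_mul_lt hlt
    rwa [mul_assoc] at this
  exact ⟨τ, hτ, _, hred.inv_mem_signedPerms, by group⟩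

end MinimalComplexity

/-! ### Bounded cancellation and powers in words -/

section BoundedCancellation

open FreeGroup (mk invRev)

variable {α β F : Type*} [DecidableEq β] [FunLike F (FreeGroup α) (FreeGroup β)]

/-- In the product of the images under `φ` of two words without cancellation, at most `B` letters
cancel. -/
def IsCancellationBound (φ : F) (B : ℕ) : Prop :=
  ∀ u v : List (α × Bool), FreeGroup.IsReduced (u ++ v) →
    gromovProduct (φ (mk u))⁻¹ (φ (mk v)) ≤ B

variable [MonoidHomClass F (FreeGroup α) (FreeGroup β)]

theorem norm_apply_mk_le {φ : F} {L : ℕ} (hL : ∀ l, (φ (mk [l])).norm ≤ L)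
    (w : List (α × Bool)) : (φ (mk w)).norm ≤ L * w.length := by
  induction w with
  | nil => simp [← FreeGroup.one_eq_mk]
  | cons l w ih =>
    calc (φ (mk (l :: w))).norm = (φ (mk [l]) * φ (mk w)).norm := by rw [← map_mul, ← mk_cons]
      _ ≤ (φ (mk [l])).norm + (φ (mk w)).norm := FreeGroup.norm_mul_le _ _
      _ ≤ L + L * w.length := add_le_add (hL l) ih
      _ = L * (l :: w).length := by rw [List.length_cons]; ring

theorem exists_norm_apply_le [DecidableEq α] [Finite α] (φ : F) :
    ∃ L, ∀ u, (φ u).norm ≤ L * u.norm := by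
  obtain ⟨L, hL⟩ := (Set.finite_range fun l : α × Bool => (φ (mk [l])).norm).bddAbove
  refine ⟨L, fun u => ?_⟩
  have hu := norm_apply_mk_le (fun l => hL ⟨l, rfl⟩) u.toWord
  rwa [FreeGroup.mk_toWord] at hu

theorem exists_le_gromovProduct_take {φ : F} {L : ℕ} (hL : ∀ l, (φ (mk [l])).norm ≤ L)
    (v : List (α × Bool)) {m : ℕ} (hm : m ≤ (φ (mk v)).norm) :
    ∃ k, m ≤ gromovProduct (φ (mk (v.take k))) (φ (mk v)) ∧ (φ (mk (v.take k))).norm ≤ m + L := by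
  classical
  have hex : ∃ k, m ≤ gromovProduct (φ (mk (v.take k))) (φ (mk v)) :=
    ⟨v.length, by rwa [List.take_length, gromovProduct_self]⟩
  refine ⟨Nat.find hex, Nat.find_spec hex, ?_⟩
  have hspec := Nat.find_spec hex
  rcases hk : Nat.find hex with _ | j
  · simp [← FreeGroup.one_eq_mk]
  rw [hk] at hspec
  have hj : ¬ m ≤ gromovProduct (φ (mk (v.take j))) (φ (mk v)) := Nat.find_min hex (by lia)
  have hstep : ((φ (mk (v.take j)))⁻¹ * φ (mk (v.take (j + 1)))).norm ≤ L := by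
    rw [List.take_add, ← FreeGroup.mul_mk, map_mul, inv_mul_cancel_left]
    exact (norm_apply_mk_le hL _).trans
      ((Nat.mul_le_mul_left L (List.length_take_le 1 _)).trans_eq (mul_one L))
  have hmin := min_gromovProduct_le (φ (mk (v.take j))) (φ (mk (v.take (j + 1)))) (φ (mk v))
  have hnorm := norm_inv_mul_add (φ (mk (v.take j))) (φ (mk (v.take (j + 1))))
  have hle := gromovProduct_le_left (φ (mk (v.take j))) (φ (mk (v.take (j + 1))))
  lia

theorem isReduced_invRev_take_append_take {u v : List (α × Bool)}
    (huv : FreeGroup.IsReduced (u ++ v)) (k j : ℕ) :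
    FreeGroup.IsReduced (invRev ((invRev u).take k) ++ v.take j) := by
  refine huv.infix ⟨invRev ((invRev u).drop k), v.drop j, ?_⟩
  rw [← List.append_assoc, ← FreeGroup.invRev_append, List.take_append_drop,
    FreeGroup.invRev_invRev, List.append_assoc, List.take_append_drop]

theorem isCancellationBound_of_norm_le [DecidableEq α] {φ : F} {L L' : ℕ}
    (hL : ∀ u, (φ u).norm ≤ L * u.norm) (hL' : ∀ u, u.norm ≤ L' * (φ u).norm) :
    IsCancellationBound φ (L * (L' * (2 * L))) := by
  intro u v huv
  have hletter (l : α × Bool) : (φ (mk [l])).norm ≤ L :=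
    (hL _).trans ((Nat.mul_le_mul_left L FreeGroup.norm_mk_le).trans_eq (mul_one L))
  rw [← map_inv, FreeGroup.inv_mk]
  set m := gromovProduct (φ (mk (invRev u))) (φ (mk v))
  have hmu : m ≤ (φ (mk (invRev u))).norm := gromovProduct_le_left _ _
  have hmv : m ≤ (φ (mk v)).norm := gromovProduct_le_right _ _
  obtain ⟨k, hku, hk⟩ := exists_le_gromovProduct_take hletter (invRev u) hmu
  obtain ⟨j, hjv, hj⟩ := exists_le_gromovProduct_take hletter v hmv
  set a := (invRev u).take k
  set b := v.take j
  have hclose : ((φ (mk a))⁻¹ * φ (mk b)).norm ≤ 2 * L := by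
    have hmin_av := min_gromovProduct_le (φ (mk a)) (φ (mk (invRev u))) (φ (mk v))
    have hmin_ab := min_gromovProduct_le (φ (mk a)) (φ (mk v)) (φ (mk b))
    rw [gromovProduct_comm (φ (mk v))] at hmin_ab
    have hnorm := norm_inv_mul_add (φ (mk a)) (φ (mk b))
    lia
  have hshort : a.length + b.length ≤ L' * (2 * L) := by
    rw [← FreeGroup.invRev_length, ← List.length_append,
      ← norm_mk_of_isReduced (isReduced_invRev_take_append_take huv k j), ← FreeGroup.mul_mk,
      ← FreeGroup.inv_mk]
    refine (hL' _).trans (Nat.mul_le_mul_left L' ?_)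
    rwa [map_mul, map_inv]
  calc m ≤ (φ (mk a)).norm := hku.trans (gromovProduct_le_left _ _)
    _ ≤ L * a.length := norm_apply_mk_le hletter a
    _ ≤ L * (L' * (2 * L)) := Nat.mul_le_mul_left L (by lia)

theorem exists_isCancellationBound [DecidableEq α] [Finite α] (φ : MulAut (FreeGroup α)) :
    ∃ B, IsCancellationBound φ B := by
  obtain ⟨L, hL⟩ := exists_norm_apply_le φ
  obtain ⟨L', hL'⟩ := exists_norm_apply_le φ⁻¹
  exact ⟨_, isCancellationBound_of_norm_le hL fun u => by simpa using hL' (φ u)⟩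

end BoundedCancellation

section Power

open FreeGroup (mk invRev)

variable {α β F : Type*} [DecidableEq α] [DecidableEq β]

theorem isSuffix_toWord_mul {x y : FreeGroup α} {e r : List (α × Bool)} (hy : y.toWord = e ++ r)
    (hxy : gromovProduct x⁻¹ y ≤ e.length) : r <:+ (x * y).toWord := by
  obtain ⟨p, s, t, -, ht, hst, hp⟩ := exists_toWord_eq_append x⁻¹ y
  rw [inv_inv] at hst
  have hlen := congrArg List.length (hy.symm.trans ht)
  rw [List.length_append, List.length_append] at hlen
  have hrt : r <:+ t := List.suffix_of_suffix_length_le ⟨e, hy.symm⟩ ⟨p, ht.symm⟩ (by lia)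
  exact hst ▸ hrt.trans (List.suffix_append _ _)

theorem isInfix_toWord_mul {x y : FreeGroup α} {z f : List (α × Bool)} (hx : z ++ f <:+ x.toWord)
    (hxy : gromovProduct x⁻¹ y ≤ f.length) : z <:+: (x * y).toWord := by
  obtain ⟨e, he⟩ := hx
  obtain ⟨p, s, t, hp, -, hst, hlen⟩ := exists_toWord_eq_append x⁻¹ y
  rw [inv_inv] at hst
  have hxp : x.toWord = invRev s ++ invRev p := by
    rw [← FreeGroup.invRev_append, ← hp, FreeGroup.toWord_inv, FreeGroup.invRev_invRev]
  have hlen' := congrArg List.length (he.trans hxp)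
  simp only [List.length_append, FreeGroup.invRev_length] at hlen'
  have hez : e ++ z <+: invRev s :=
    List.prefix_of_prefix_length_le ⟨f, by rw [← he, List.append_assoc]⟩ ⟨invRev p, hxp.symm⟩
      (by rw [List.length_append, FreeGroup.invRev_length]; lia)
  exact hst ▸ (List.suffix_append e z).isInfix.trans (hez.trans (List.prefix_append _ _)).isInfix

/-- The reduced word of `w` contains a `k`-th power of a non-empty word. -/
def HasPower (w : FreeGroup α) (k : ℕ) : Prop :=
  ∃ y : List (α × Bool), y ≠ [] ∧ (List.replicate k y).flatten <:+: w.toWord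

theorem le_length_flatten_replicate {γ : Type*} {y : List γ} (hy : y ≠ []) (k : ℕ) :
    k ≤ (List.replicate k y).flatten.length := by
  simp only [List.length_flatten, List.map_replicate, List.sum_replicate, smul_eq_mul]
  exact Nat.le_mul_of_pos_right k (List.length_pos_of_ne_nil hy)

theorem HasPower.le_norm {w : FreeGroup α} {k : ℕ} (h : HasPower w k) : k ≤ w.norm := by
  obtain ⟨y, hy, hw⟩ := h
  exact (le_length_flatten_replicate hy k).trans hw.length_le

theorem HasPower.mono {w : FreeGroup α} {k j : ℕ} (h : HasPower w k) (hj : j ≤ k) :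
    HasPower w j := by
  obtain ⟨y, hy, hw⟩ := h
  obtain ⟨i, rfl⟩ := Nat.exists_eq_add_of_le hj
  refine ⟨y, hy, List.IsInfix.trans ?_ hw⟩
  rw [List.replicate_add, List.flatten_append]
  exact (List.prefix_append _ _).isInfix

theorem exists_toWord_pow_eq_append {g : FreeGroup α} (hg : g ≠ 1) {k B : ℕ} (hk : 2 * B < k) :
    ∃ e f z, z ≠ [] ∧ (g ^ k).toWord = e ++ ((List.replicate (k - 2 * B) z).flatten ++ f) ∧
      B ≤ e.length ∧ B ≤ f.length := by
  obtain ⟨j, rfl⟩ : ∃ j, k = j + 1 := ⟨k - 1, by lia⟩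
  set c := FreeGroup.reduceCyclically.conjugator g.toWord
  set z := FreeGroup.reduceCyclically g.toWord
  have hz : z ≠ [] := reduceCyclically_toWord_ne_nil hg
  have hsplit : (List.replicate (j + 1) z).flatten = (List.replicate B z).flatten ++
      (List.replicate (j + 1 - 2 * B) z).flatten ++ (List.replicate B z).flatten := by
    simp only [← List.flatten_append, ← List.replicate_add]
    congr 2
    lia
  refine ⟨c ++ (List.replicate B z).flatten, (List.replicate B z).flatten ++ invRev c, z, hz, ?_,
    ?_, ?_⟩
  · rw [toWord_pow_succ, hsplit]
    simp only [List.append_assoc, c, z]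
  all_goals
    rw [List.length_append]
    have := le_length_flatten_replicate hz B
    lia

theorem HasPower.apply [FunLike F (FreeGroup α) (FreeGroup β)]
    [MonoidHomClass F (FreeGroup α) (FreeGroup β)] {φ : F} (hφ : Function.Injective φ) {B : ℕ}
    (hB : IsCancellationBound φ B) {w : FreeGroup α} {k : ℕ} (h : HasPower w k) (hk : 2 * B < k) :
    HasPower (φ w) (k - 2 * B) := by
  obtain ⟨y, hy, P, Q, hw⟩ := h
  set M := (List.replicate k y).flatten with hM
  have hred : FreeGroup.IsReduced (P ++ M ++ Q) := hw ▸ FreeGroup.isReduced_toWord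
  have hy_red : FreeGroup.IsReduced y := by
    obtain ⟨j, rfl⟩ : ∃ j, k = j + 1 := ⟨k - 1, by lia⟩
    rw [hM, List.replicate_succ, List.flatten_cons] at hred
    exact hred.infix ((List.prefix_append _ _).isInfix.trans ⟨P, Q, rfl⟩)
  have hy_ne : φ (mk y) ≠ 1 := by
    rwa [map_ne_one_iff φ hφ, Ne, ← FreeGroup.toWord_eq_nil_iff, toWord_mk_of_isReduced hy_red]
  obtain ⟨e, f, z, hz, hM_word, he, hf⟩ := exists_toWord_pow_eq_append hy_ne hk
  rw [← map_pow, FreeGroup.pow_mk, ← hM] at hM_word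
  refine ⟨z, hz, ?_⟩
  have hPM := isSuffix_toWord_mul (x := φ (mk P)) hM_word
    ((hB P M (hred.infix (List.prefix_append _ _).isInfix)).trans he)
  rw [← map_mul, FreeGroup.mul_mk] at hPM
  have hPMQ := isInfix_toWord_mul hPM ((hB _ Q hred).trans hf)
  rwa [← map_mul, FreeGroup.mul_mk, hw, FreeGroup.mk_toWord] at hPMQ

end Power

section Conjugate

open FreeGroup (mk invRev)

variable {α : Type*}

theorem isCyclicallyReduced_append_comm {v w : List (α × Bool)}
    (h : FreeGroup.IsCyclicallyReduced (v ++ w)) : FreeGroup.IsCyclicallyReduced (w ++ v) := by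
  have hthree := (h.flatten_replicate 3).isReduced
  have htwo : FreeGroup.IsReduced ((w ++ v) ++ (w ++ v)) :=
    hthree.infix ⟨v, w, by simp [List.replicate_succ]⟩
  exact ⟨htwo.infix (List.prefix_append _ _).isInfix, (List.isChain_append.1 htwo).2.2⟩

theorem mk_append_singleton_mul_mul_inv {U V W : List (α × Bool)} {l : α × Bool}
    (h : mk [l] * mk W = mk V * mk [l]) :
    mk (U ++ [l]) * mk W * (mk (U ++ [l]))⁻¹ = mk U * mk V * (mk U)⁻¹ := by
  rw [← FreeGroup.mul_mk, mul_assoc (mk U), h]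
  group

theorem exists_isRotated_toWord_conj [DecidableEq α] {U W : List (α × Bool)}
    (hU : FreeGroup.IsReduced U) (hW : FreeGroup.IsCyclicallyReduced W) (hne : W ≠ []) :
    ∃ c V, V ~r W ∧ (mk U * mk W * (mk U)⁻¹).toWord = c ++ V ++ invRev c := by
  induction U using List.reverseRecOn generalizing W with
  | nil =>
    refine ⟨[], W, List.IsRotated.refl W, ?_⟩
    simp [← FreeGroup.one_eq_mk, hW.isReduced.reduce_eq]
  | append_singleton U l ih =>
    have hU' : FreeGroup.IsReduced U := hU.infix (List.prefix_append _ _).isInfix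
    rcases Classical.em (invLetter l ∈ W.head?) with hhead | hhead
    · obtain ⟨W, rfl⟩ := List.head?_eq_some_iff.1 hhead
      obtain ⟨c, V, hV, hword⟩ := ih (W := W ++ [invLetter l]) hU'
        (isCyclicallyReduced_append_comm (v := [invLetter l]) hW) (by simp)
      refine ⟨c, V, hV.trans (List.isRotated_append (l := W) (l' := [invLetter l])), ?_⟩
      rw [mk_append_singleton_mul_mul_inv, hword]
      rw [mk_cons (invLetter l) W, ← FreeGroup.mul_mk, mk_invLetter, mul_inv_cancel_left,
        inv_mul_cancel_right]
    rcases Classical.em (l ∈ W.getLast?) with hlast | hlast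
    · obtain ⟨W, rfl⟩ := List.getLast?_eq_some_iff.1 hlast
      obtain ⟨c, V, hV, hword⟩ := ih (W := l :: W) hU'
        (isCyclicallyReduced_append_comm (w := [l]) hW) (by simp)
      refine ⟨c, V, hV.trans (List.isRotated_append (l := [l]) (l' := W)), ?_⟩
      rw [mk_append_singleton_mul_mul_inv, hword]
      rw [mk_cons l W, ← FreeGroup.mul_mk, mul_assoc]
    · refine ⟨U ++ [l], W, List.IsRotated.refl W, ?_⟩
      rw [FreeGroup.inv_mk, FreeGroup.mul_mk, FreeGroup.mul_mk, toWord_mk_of_isReduced]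
      refine isReduced_append_iff.2 ⟨isReduced_append_iff.2 ⟨hU, hW.isReduced, ?_⟩,
        isReduced_invRev hU, ?_⟩
      · simp only [List.getLast?_append, List.getLast?_singleton, Option.some_or,
          Option.mem_some_iff, forall_eq']
        rintro b hb rfl
        exact hhead (by rwa [invLetter_invLetter])
      · rw [List.getLast?_append_of_ne_nil _ hne, FreeGroup.invRev_append]
        rintro a ha b hb rfl
        obtain rfl : invLetter l = b := by simpa [invRev, invLetter] using hb
        exact hlast (by rwa [invLetter_invLetter] at ha)

theorem isInfix_replicate_half_of_isRotated {γ : Type*} {s : γ} {k : ℕ} {V W : List γ}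
    (h : List.replicate k s <:+: W) (hVW : V ~r W) : List.replicate (k / 2) s <:+: V := by
  have hmono {i j : ℕ} (hij : i ≤ j) : List.replicate i s <:+: List.replicate j s := by
    obtain ⟨m, rfl⟩ := Nat.exists_eq_add_of_le hij
    exact List.replicate_add i m s ▸ (List.prefix_append _ _).isInfix
  obtain ⟨n, hn, rfl⟩ := List.isRotated_iff_mod.1 hVW
  rw [List.rotate_eq_drop_append_take hn] at h
  rw [← List.take_append_drop n V]
  rcases List.infix_append_iff.1 h with hdrop | htake | ⟨p, q, hpq, hp, hq⟩
  · exact (hmono (Nat.div_le_self k 2)).trans (hdrop.trans (List.suffix_append _ _).isInfix)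
  · exact (hmono (Nat.div_le_self k 2)).trans (htake.trans (List.prefix_append _ _).isInfix)
  obtain ⟨hlen, hp_rep, hq_rep⟩ := List.append_eq_replicate_iff.1 hpq.symm
  rcases le_total (k / 2) p.length with hpk | hqk
  · rw [hp_rep] at hp
    exact (hmono hpk).trans (hp.isInfix.trans (List.suffix_append _ _).isInfix)
  · rw [hq_rep] at hq
    exact (hmono (by lia)).trans (hq.isInfix.trans (List.prefix_append _ _).isInfix)

theorem hasPower_conj [DecidableEq α] {W : List (α × Bool)}
    (hW : FreeGroup.IsCyclicallyReduced W) (hne : W ≠ []) {s : α × Bool} {k : ℕ}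
    (h : List.replicate k s <:+: W) (u : FreeGroup α) : HasPower (u * mk W * u⁻¹) (k / 2) := by
  obtain ⟨c, V, hV, hword⟩ := exists_isRotated_toWord_conj (FreeGroup.isReduced_toWord (x := u))
    hW hne
  rw [FreeGroup.mk_toWord] at hword
  refine ⟨[s], by simp, ?_⟩
  rw [hword, List.flatten_replicate_singleton]
  exact (isInfix_replicate_half_of_isRotated h hV).trans (List.infix_append c V (invRev c))

end Conjugate

/-! ### Word norms and undistorted pairs -/

section WordNorm

variable {G H : Type*} [Group G] [Group H]

theorem wordNorm_prod_le {S : Set G} {w : List G} (hw : ∀ x ∈ w, x ∈ S ∨ x⁻¹ ∈ S) :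
    wordNorm S w.prod ≤ w.length :=
  Nat.sInf_le ⟨w, hw, rfl, rfl⟩

theorem wordNorm_map_le {S : Set G} (hS : Subgroup.closure S = ⊤) (f : G →* H) (g : G) :
    wordNorm (f '' S) (f g) ≤ wordNorm S g := by
  obtain ⟨w, hw, rfl, hlen⟩ := exists_word hS g
  rw [← hlen, map_list_prod, ← List.length_map f]
  refine wordNorm_prod_le (List.forall_mem_map.2 fun y hy => ?_)
  exact (hw y hy).imp (Set.mem_image_of_mem f) fun h => ⟨y⁻¹, h, map_inv f y⟩

theorem closure_image_eq_top {S : Set G} (hS : Subgroup.closure S = ⊤) {f : G →* H}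
    (hf : Function.Surjective f) : Subgroup.closure (f '' S) = ⊤ := by
  rw [← MonoidHom.map_closure, hS, Subgroup.map_top_of_surjective f hf]

theorem wordNorm_list_prod_le {S : Set G} (hS : Subgroup.closure S = ⊤) {C : ℕ} {w : List G}
    (hw : ∀ x ∈ w, wordNorm S x ≤ C) : wordNorm S w.prod ≤ C * w.length := by
  induction w with
  | nil => simp [wordNorm_one]
  | cons x w ih =>
    obtain ⟨hx, hw⟩ := List.forall_mem_cons.1 hw
    rw [List.prod_cons, List.length_cons]
    linarith [wordNorm_mul_le hS x w.prod, ih hw]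

theorem exists_wordNorm_apply_le {S : Set G} (hS : Subgroup.closure S = ⊤) {T : Set H}
    (hT : T.Finite) (hT_top : Subgroup.closure T = ⊤) (f : H →* G) :
    ∃ C : ℕ, ∀ h, wordNorm S (f h) ≤ C * wordNorm T h := by
  obtain ⟨C, hC⟩ := (hT.image fun t => wordNorm S (f t)).bddAbove
  refine ⟨C, fun h => ?_⟩
  obtain ⟨w, hw, rfl, hlen⟩ := exists_word hT_top h
  rw [← hlen, map_list_prod, ← List.length_map f]
  refine wordNorm_list_prod_le hS (List.forall_mem_map.2 fun x hx => ?_)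
  rcases hw x hx with hx | hx
  · exact hC ⟨x, hx, rfl⟩
  · rw [← wordNorm_inv hS, ← map_inv]
    exact hC ⟨x⁻¹, hx, rfl⟩

theorem wordNorm_zpow_le {S : Set G} (hS : Subgroup.closure S = ⊤) (g : G) (a : ℤ) :
    wordNorm S (g ^ a) ≤ wordNorm S g * a.natAbs := by
  have hpow (m : ℕ) : wordNorm S (g ^ m) ≤ wordNorm S g * m := by
    simpa using wordNorm_list_prod_le (w := List.replicate m g) hS fun x hx =>
      (congrArg (wordNorm S) (List.eq_of_mem_replicate hx)).le
  obtain ⟨m, rfl | rfl⟩ := a.eq_nat_or_neg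
  · simpa using hpow m
  · rw [zpow_neg, wordNorm_inv hS]
    simpa using hpow m

theorem wordNorm_zpow_mul_zpow_le {T : Set G} (hT : Subgroup.closure T = ⊤) (g h : G) (a b : ℤ) :
    wordNorm T (g ^ a * h ^ b) ≤
      (wordNorm T g + wordNorm T h) * (a.natAbs + b.natAbs) := by
  nlinarith [wordNorm_mul_le hT (g ^ a) (h ^ b), wordNorm_zpow_le hT g a, wordNorm_zpow_le hT h b,
    Nat.zero_le (wordNorm T g * b.natAbs), Nat.zero_le (wordNorm T h * a.natAbs)]

end WordNorm

section UndistortedPair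

variable {G H : Type*} [Group G] [Group H] {φ ψ : G}

/-- The elements `φ` and `ψ` commute, and the word norm of `φ ^ a * ψ ^ b` grows at least linearly
in `|a| + |b|`. The additive constant in the bound makes `linear_growth` easier to check; it can be
removed by enlarging `K`. -/
structure IsUndistortedPair (φ ψ : G) : Prop where
  commute : Commute φ ψ
  linear_growth : ∀ S : Set G, S.Finite → Subgroup.closure S = ⊤ →
    ∃ K : ℕ, ∀ a b : ℤ, a.natAbs + b.natAbs ≤ K * (wordNorm S (φ ^ a * ψ ^ b) + 1)

/-- The homomorphism `(a, b) ↦ φ ^ a * ψ ^ b` for commuting `φ` and `ψ`. -/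
def zpowPairHom (h : Commute φ ψ) : Multiplicative (ℤ × ℤ) →* G where
  toFun x := φ ^ x.toAdd.1 * ψ ^ x.toAdd.2
  map_one' := by simp
  map_mul' x y := by
    simp only [toAdd_mul, Prod.fst_add, Prod.snd_add, zpow_add]
    exact ((h.zpow_zpow _ _).mul_mul_mul_comm _ _)

theorem zpowPairHom_apply (h : Commute φ ψ) (x : Multiplicative (ℤ × ℤ)) :
    zpowPairHom h x = φ ^ x.toAdd.1 * ψ ^ x.toAdd.2 := rfl

theorem range_zpowPairHom (h : Commute φ ψ) :
    (zpowPairHom h).range = Subgroup.closure {φ, ψ} := by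
  refine le_antisymm ?_ ((Subgroup.closure_le _).2 (Set.pair_subset ?_ ?_))
  · rintro _ ⟨x, rfl⟩
    exact mul_mem (zpow_mem (Subgroup.subset_closure (by simp)) _)
      (zpow_mem (Subgroup.subset_closure (by simp)) _)
  · exact ⟨Multiplicative.ofAdd (1, 0), by simp [zpowPairHom_apply]⟩
  · exact ⟨Multiplicative.ofAdd (0, 1), by simp [zpowPairHom_apply]⟩

namespace IsUndistortedPair

theorem injective_zpowPairHom [hG : Group.FG G] (h : IsUndistortedPair φ ψ) :
    Function.Injective (zpowPairHom h.commute) := by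
  obtain ⟨S, hS⟩ := hG.out
  obtain ⟨K, hK⟩ := h.linear_growth S S.finite_toSet hS
  refine (injective_iff_map_eq_one _).2 fun x hx => ?_
  have hbounded (m : ℕ) : m * (x.toAdd.1.natAbs + x.toAdd.2.natAbs) ≤ K := by
    have hm := hK (x ^ m).toAdd.1 (x ^ m).toAdd.2
    rw [← zpowPairHom_apply h.commute, map_pow (zpowPairHom h.commute), hx, one_pow,
      wordNorm_one] at hm
    simpa [Int.natAbs_mul, mul_add] using hm
  have hx_zero : x.toAdd.1.natAbs + x.toAdd.2.natAbs = 0 := by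
    by_contra hne
    exact (hbounded (K + 1)).not_gt (Nat.le_mul_of_pos_right (K + 1) (Nat.pos_of_ne_zero hne))
  have hfst : x.toAdd.1 = 0 := by lia
  have hsnd : x.toAdd.2 = 0 := by lia
  exact Multiplicative.toAdd.injective (Prod.ext hfst hsnd)

theorem nonempty_mulEquiv [Group.FG G] (h : IsUndistortedPair φ ψ) :
    Nonempty (Subgroup.closure {φ, ψ} ≃* Multiplicative (ℤ × ℤ)) :=
  ⟨((MonoidHom.ofInjective h.injective_zpowPairHom).trans
    (MulEquiv.subgroupCongr (range_zpowPairHom h.commute))).symm⟩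

theorem infinite_zpowers [Group.FG G] (h : IsUndistortedPair φ ψ) :
    (Subgroup.zpowers φ : Set G).Infinite := by
  refine Set.infinite_range_of_injective (f := fun a : ℤ => φ ^ a) fun a b hab => ?_
  have hpair := h.injective_zpowPairHom (a₁ := Multiplicative.ofAdd (a, 0))
    (a₂ := Multiplicative.ofAdd (b, 0)) (by simpa [zpowPairHom_apply] using hab)
  simpa using hpair

theorem exists_wordNorm_le (h : IsUndistortedPair φ ψ) {S : Set G} (hS : S.Finite)
    (hS_top : Subgroup.closure S = ⊤) {T : Set (Subgroup.closure {φ, ψ})}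
    (hT : Subgroup.closure T = ⊤) :
    ∃ C : ℕ, ∀ g : Subgroup.closure {φ, ψ}, wordNorm T g ≤ C * wordNorm S (g : G) := by
  obtain ⟨K, hK⟩ := h.linear_growth S hS hS_top
  let φ' : Subgroup.closure {φ, ψ} := ⟨φ, Subgroup.subset_closure (by simp)⟩
  let ψ' : Subgroup.closure {φ, ψ} := ⟨ψ, Subgroup.subset_closure (by simp)⟩
  set D := wordNorm T φ' + wordNorm T ψ'
  refine ⟨D * (K * 2), fun g => ?_⟩
  rcases eq_or_ne g 1 with rfl | hg_ne
  · simp [wordNorm_one]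
  have hpos : 1 ≤ wordNorm S (g : G) := Nat.one_le_iff_ne_zero.2 fun h0 =>
    hg_ne (Subtype.ext (eq_one_of_wordNorm hS_top h0))
  obtain ⟨x, hx⟩ : (g : G) ∈ (zpowPairHom h.commute).range := by
    rw [range_zpowPairHom]
    exact g.2
  rw [zpowPairHom_apply] at hx
  calc wordNorm T g = wordNorm T (φ' ^ x.toAdd.1 * ψ' ^ x.toAdd.2) := by
        rw [show g = φ' ^ x.toAdd.1 * ψ' ^ x.toAdd.2 from Subtype.ext hx.symm]
    _ ≤ D * (x.toAdd.1.natAbs + x.toAdd.2.natAbs) := wordNorm_zpow_mul_zpow_le hT φ' ψ' _ _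
    _ ≤ D * (K * (wordNorm S (g : G) + 1)) := Nat.mul_le_mul_left D (hx ▸ hK _ _)
    _ ≤ D * (K * (wordNorm S (g : G) * 2)) := by gcongr; lia
    _ = D * (K * 2) * wordNorm S (g : G) := by ring

theorem isUndistorted (h : IsUndistortedPair φ ψ) :
    IsUndistorted (Subgroup.closure {φ, ψ}) := by
  intro S hS hS_top T hT hT_top
  obtain ⟨C, hC⟩ := h.exists_wordNorm_le hS hS_top hT_top
  obtain ⟨D, hD⟩ := exists_wordNorm_apply_le hS_top hT hT_top (Subgroup.closure {φ, ψ}).subtype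
  refine ⟨(C + D + 1 : ℕ), by positivity, fun g => ⟨?_, ?_⟩⟩
  · exact_mod_cast (hC g).trans (Nat.mul_le_mul_right _ (by lia))
  · exact_mod_cast (hD g).trans (Nat.mul_le_mul_right _ (by lia))

theorem of_map {f : G →* H} (hf : Function.Surjective f) (hc : Commute φ ψ)
    (h : IsUndistortedPair (f φ) (f ψ)) : IsUndistortedPair φ ψ where
  commute := hc
  linear_growth S hS hS_top := by
    obtain ⟨K, hK⟩ := h.linear_growth (f '' S) (hS.image f) (closure_image_eq_top hS_top hf)
    refine ⟨K, fun a b => (hK a b).trans ?_⟩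
    rw [← map_zpow, ← map_zpow, ← map_mul]
    gcongr
    exact wordNorm_map_le hS_top f _

theorem symm (h : IsUndistortedPair φ ψ) : IsUndistortedPair ψ φ where
  commute := h.commute.symm
  linear_growth S hS hS_top := by
    obtain ⟨K, hK⟩ := h.linear_growth S hS hS_top
    refine ⟨K, fun a b => ?_⟩
    rw [add_comm, ← (h.commute.zpow_zpow b a).eq]
    exact hK b a

end IsUndistortedPair

end UndistortedPair

section OutGrowth

open FreeGroup (mk)

variable {α : Type*} [DecidableEq α] [Finite α] {S : Set (Out (FreeGroup α))}

theorem exists_representative_forall_hasPower (hS : S.Finite) (hS_top : Subgroup.closure S = ⊤) :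
    ∃ B : ℕ, ∀ x : Out (FreeGroup α), ∃ τ : MulAut (FreeGroup α), QuotientGroup.mk τ = x ∧
      ∀ w k, HasPower w k → HasPower (τ w) (k - B * wordNorm S x) := by
  choose B hB using exists_isCancellationBound (α := α)
  obtain ⟨C, hC⟩ := ((hS.union hS.inv).image fun x => B x.out).bddAbove
  refine ⟨2 * C, fun x => ?_⟩
  obtain ⟨L, hL, rfl, hlen⟩ := exists_word hS_top x
  rw [← hlen]
  clear hlen
  induction L with
  | nil => exact ⟨1, rfl, fun w k h => by simpa using h⟩
  | cons x L ih =>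
    obtain ⟨hx, hL⟩ := List.forall_mem_cons.1 hL
    obtain ⟨τ, hτ, hpower⟩ := ih hL
    have hBx : B x.out ≤ C := hC ⟨x, hx, rfl⟩
    refine ⟨x.out * τ, ?_, fun w k h => ?_⟩
    · rw [QuotientGroup.mk_mul, hτ, List.prod_cons, QuotientGroup.out_eq']
    rw [List.length_cons, mul_add, mul_one, ← Nat.sub_sub, MulAut.mul_apply]
    have hτw := hpower w k h
    rcases le_or_gt (k - 2 * C * L.length) (2 * B x.out) with hk | hk
    · obtain ⟨y, hy, -⟩ := h
      exact ⟨y, hy, by simp [Nat.sub_eq_zero_of_le (hk.trans (Nat.mul_le_mul_left 2 hBx))]⟩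
    · exact (hτw.apply x.out.injective (hB x.out) hk).mono (by lia)

theorem exists_le_wordNorm_add_norm (hS : S.Finite) (hS_top : Subgroup.closure S = ⊤) :
    ∃ B : ℕ, ∀ (θ : MulAut (FreeGroup α)) (w : FreeGroup α) (k : ℕ),
      (∀ g, HasPower (g * θ w * g⁻¹) k) → k ≤ B * wordNorm S (QuotientGroup.mk θ) + w.norm := by
  obtain ⟨B, hB⟩ := exists_representative_forall_hasPower hS hS_top
  refine ⟨B, fun θ w k hpower => ?_⟩
  obtain ⟨τ, hτ, hτ_power⟩ := hB (QuotientGroup.mk θ)⁻¹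
  obtain ⟨g, hg⟩ : τ * θ ∈ Inn (FreeGroup α) := by
    rw [← QuotientGroup.eq_one_iff, QuotientGroup.mk_mul, hτ, inv_mul_cancel]
  obtain ⟨a, ha⟩ := τ.surjective g⁻¹
  have hw : τ (a * θ w * a⁻¹) = w := by
    have hτθ : τ (θ w) = g * w * g⁻¹ := by rw [← MulAut.mul_apply, ← hg, MulAut.conj_apply]
    rw [map_mul, map_mul, map_inv, ha, hτθ]
    group
  have hle := (hτ_power _ k (hpower a)).le_norm
  rw [hw, wordNorm_inv hS_top] at hle
  lia

end OutGrowth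

/-! ### Asymptotic cones of lattices -/

section Lattice

variable {ι : Type*} {X : Type*} {c : X ≃ (ι → ℤ)} {b : ℕ → X} {d : ℕ → ℝ≥0}

/-- The coordinates of `y i` relative to the observation point `b i`, at scale `d i`. -/
noncomputable def rescaledCoords (c : X ≃ (ι → ℤ)) (b : ℕ → X) (d : ℕ → ℝ≥0) (y : ℕ → X) (i : ℕ) :
    ι → ℝ :=
  fun j => (c (y i) j - c (b i) j : ℝ) / d i

theorem rescaledCoords_self (i : ℕ) : rescaledCoords c b d b i = 0 := by
  ext j
  simp [rescaledCoords]

theorem tendsto_floor_mul_div_atTop (x : ℝ) :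
    Tendsto (fun t : ℝ => (⌊x * t⌋ : ℝ) / t) atTop (𝓝 x) := by
  have hlower : Tendsto (fun t : ℝ => x - t⁻¹) atTop (𝓝 x) := by
    simpa using (tendsto_const_nhds (x := x)).sub (tendsto_inv_atTop_zero (𝕜 := ℝ))
  refine tendsto_of_tendsto_of_tendsto_of_le_of_le' hlower tendsto_const_nhds ?_ ?_
  · filter_upwards [eventually_gt_atTop 0] with t ht
    rw [le_div_iff₀ ht, sub_mul, inv_mul_cancel₀ ht.ne']
    exact (Int.sub_one_lt_floor _).le
  · filter_upwards [eventually_gt_atTop 0] with t ht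
    exact (div_le_iff₀ ht).2 (Int.floor_le _)

variable [Fintype ι] [MetricSpace X] {ω : Ultrafilter ℕ}

/-- The bijection `c` is an isometry from `X` to the lattice `ι → ℤ` with the `ℓ¹` metric (the
metric that Mathlib puts on `ι → ℤ` is the supremum metric). -/
def IsLatticeChart (c : X ≃ (ι → ℤ)) : Prop :=
  ∀ x y, dist x y = ∑ j, |(c x j - c y j : ℝ)|

theorem IsLatticeChart.nearBiinfiniteGeodesics [Nonempty ι] (hc : IsLatticeChart c) :
    NearBiinfiniteGeodesics X := by
  classical
  obtain ⟨j⟩ := ‹Nonempty ι›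
  refine ⟨0, fun x => ⟨fun k => c.symm (c x + Pi.single j k), ?_, 0, by simp⟩⟩
  refine Isometry.of_dist_eq fun k l => ?_
  rw [hc, Finset.sum_eq_single_of_mem j (Finset.mem_univ j) fun i _ hi => by simp [hi]]
  simp [Int.dist_eq]

theorem IsLatticeChart.dist_div_eq (hc : IsLatticeChart c) (y z : ℕ → X) (i : ℕ) :
    dist (y i) (z i) / d i =
      ∑ j, |rescaledCoords c b d y i j - rescaledCoords c b d z i j| := by
  rw [hc, Finset.sum_div]
  refine Finset.sum_congr rfl fun j _ => ?_
  rw [rescaledCoords, rescaledCoords, ← sub_div, sub_sub_sub_cancel_right, abs_div,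
    abs_of_nonneg (d i).coe_nonneg]

theorem IsLatticeChart.tendsto_dist_div (hc : IsLatticeChart c) {y z : ℕ → X} {p q : ι → ℝ}
    (hy : Tendsto (rescaledCoords c b d y) ω (𝓝 p))
    (hz : Tendsto (rescaledCoords c b d z) ω (𝓝 q)) :
    Tendsto (fun i => dist (y i) (z i) / d i) ω (𝓝 (∑ j, |p j - q j|)) := by
  simp only [hc.dist_div_eq (b := b)]
  exact tendsto_finsetSum _ fun j _ =>
    ((tendsto_pi_nhds.1 hy j).sub (tendsto_pi_nhds.1 hz j)).abs

theorem IsLatticeChart.dist_coneSeq_eq (hc : IsLatticeChart c) {y z : ConeSeq ω b d}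
    {p q : ι → ℝ} (hy : Tendsto (rescaledCoords c b d y.1) ω (𝓝 p))
    (hz : Tendsto (rescaledCoords c b d z.1) ω (𝓝 q)) : dist y z = ∑ j, |p j - q j| :=
  tendsto_nhds_unique (ConeSeq.tendsto_dist y z) (hc.tendsto_dist_div hy hz)

theorem IsLatticeChart.exists_tendsto_rescaledCoords (hc : IsLatticeChart c)
    (y : ConeSeq ω b d) : ∃ p, Tendsto (rescaledCoords c b d y.1) ω (𝓝 p) := by
  obtain ⟨C, hC⟩ := y.2
  have hball : ∀ᶠ i in (ω : Filter ℕ),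
      rescaledCoords c b d y.1 i ∈ Metric.closedBall (0 : ι → ℝ) C := by
    filter_upwards [hC] with i hi
    rw [hc.dist_div_eq (b := b)] at hi
    simp only [rescaledCoords_self, Pi.zero_apply, sub_zero] at hi
    rw [mem_closedBall_zero_iff]
    refine le_trans ((pi_norm_le_iff_of_nonneg (by positivity)).2 fun j => ?_) hi
    exact Finset.single_le_sum (f := fun j => |rescaledCoords c b d y.1 i j|)
      (fun _ _ => abs_nonneg _) (Finset.mem_univ j)
  obtain ⟨p, -, hp⟩ := (isCompact_closedBall (0 : ι → ℝ) C).ultrafilter_le_nhds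
    (ω.map (rescaledCoords c b d y.1)) (le_principal_iff.2 hball)
  exact ⟨p, hp⟩

theorem IsLatticeChart.exists_coneSeq_tendsto (hc : IsLatticeChart c) (hd : Tendsto d ω atTop)
    (b : ℕ → X) (p : ι → ℝ) :
    ∃ y : ConeSeq ω b d, Tendsto (rescaledCoords c b d y.1) ω (𝓝 p) := by
  let y (i : ℕ) : X := c.symm fun j => c (b i) j + ⌊p j * d i⌋
  have hy : Tendsto (rescaledCoords c b d y) ω (𝓝 p) :=
    tendsto_pi_nhds.2 fun j => by
      simpa [y, rescaledCoords, Function.comp_def] using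
        (tendsto_floor_mul_div_atTop (p j)).comp (NNReal.tendsto_coe_atTop.2 hd)
  have hb : Tendsto (rescaledCoords c b d b) ω (𝓝 0) :=
    tendsto_const_nhds.congr fun i => (rescaledCoords_self i).symm
  have hbounded := (hc.tendsto_dist_div hy hb).eventually (gt_mem_nhds (lt_add_one _))
  exact ⟨⟨y, _, hbounded.mono fun i hi => hi.le⟩, hy⟩

theorem IsLatticeChart.exists_continuous_bijective (hc : IsLatticeChart c)
    (hd : Tendsto d ω atTop) (b : ℕ → X) :
    ∃ F : (ι → ℝ) → AsymptoticCone ω b d, Continuous F ∧ Function.Bijective F := by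
  choose f hf using hc.exists_coneSeq_tendsto hd b
  have hdist (x y : ι → ℝ) : dist (f x) (f y) = ∑ j, |x j - y j| := hc.dist_coneSeq_eq (hf x) (hf y)
  have hcont : Continuous f := by
    refine (LipschitzWith.of_dist_le_mul (K := Fintype.card ι) fun x y => ?_).continuous
    rw [hdist, dist_eq_norm]
    simpa using Pi.sum_norm_apply_le_norm (x - y)
  refine ⟨fun x => SeparationQuotient.mk (f x), SeparationQuotient.continuous_mk.comp hcont,
    fun x y hxy => ?_, fun q => ?_⟩
  · have hzero : ∑ j, |x j - y j| = 0 := by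
      rw [← hdist, ← SeparationQuotient.dist_mk]
      exact dist_eq_zero.2 hxy
    rw [Finset.sum_eq_zero_iff_of_nonneg fun _ _ => abs_nonneg _] at hzero
    exact funext fun j => sub_eq_zero.1 (abs_eq_zero.1 (hzero j (Finset.mem_univ j)))
  · obtain ⟨z, rfl⟩ := SeparationQuotient.surjective_mk q
    obtain ⟨x, hx⟩ := hc.exists_tendsto_rescaledCoords z
    refine ⟨x, dist_eq_zero.1 ?_⟩
    rw [SeparationQuotient.dist_mk, hc.dist_coneSeq_eq (hf x) hx]
    simp

theorem IsLatticeChart.not_isCutPoint [Nontrivial ι] (hc : IsLatticeChart c)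
    (hd : Tendsto d ω atTop) (p : AsymptoticCone ω b d) : ¬ IsCutPoint p := by
  obtain ⟨F, hF, hbij⟩ := hc.exists_continuous_bijective hd b
  obtain ⟨x, rfl⟩ := hbij.2 p
  have hrank : 1 < Module.rank ℝ (ι → ℝ) := by
    rw [rank_fun']
    exact_mod_cast Fintype.one_lt_card
  rw [IsCutPoint, not_not, ← Set.image_singleton, ← Set.image_compl_eq hbij]
  exact (isConnected_compl_singleton_of_one_lt_rank hrank x).image F hF.continuousOn

theorem IsLatticeChart.hasConesWithoutCutPoints [Nontrivial ι] (hc : IsLatticeChart c) :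
    HasConesWithoutCutPoints X := by
  have hd : Tendsto (fun i : ℕ => (i : ℝ≥0) + 1) (hyperfilter ℕ : Filter ℕ) atTop :=
    (tendsto_atTop_mono (fun _ => le_self_add) tendsto_natCast_atTop_atTop).mono_left
      Nat.hyperfilter_le_atTop
  exact ⟨hyperfilter ℕ, fun i => (i : ℝ≥0) + 1, hyperfilter_le_cofinite, fun i => by positivity,
    hd, fun b p => hc.not_isCutPoint hd p⟩

end Lattice

section FreeAbelian

variable {ι : Type*}

/-- The standard basis of `ι → ℤ`, as a subset of the multiplicative group. -/
def standardBasis (ι : Type*) [DecidableEq ι] : Set (Multiplicative (ι → ℤ)) :=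
  Set.range fun j => Multiplicative.ofAdd (Pi.single j 1)

variable [DecidableEq ι]

theorem ofAdd_single_eq_zpow (j : ι) (a : ℤ) :
    Multiplicative.ofAdd (Pi.single j a : ι → ℤ) = Multiplicative.ofAdd (Pi.single j 1) ^ a := by
  rw [← ofAdd_zsmul, ← Pi.single_smul, smul_eq_mul, mul_one]

theorem closure_standardBasis [Finite ι] : Subgroup.closure (standardBasis ι) = ⊤ := by
  refine eq_top_iff.2 fun x _ => ?_
  have := Fintype.ofFinite ι
  rw [← ofAdd_toAdd x, ← Finset.univ_sum_single x.toAdd, ofAdd_sum]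
  refine prod_mem fun j _ => ?_
  rw [ofAdd_single_eq_zpow]
  exact zpow_mem (Subgroup.subset_closure (Set.mem_range_self j)) _

variable [Fintype ι]

theorem wordNorm_standardBasis_le (x : Multiplicative (ι → ℤ)) :
    wordNorm (standardBasis ι) x ≤ ∑ j, (x.toAdd j).natAbs := by
  have hsum := Finset.le_sum_of_subadditive
    (fun v => wordNorm (standardBasis ι) (Multiplicative.ofAdd v)) (wordNorm_one _).le
    (fun v w => wordNorm_mul_le closure_standardBasis _ _) Finset.univ
    fun j => Pi.single j (x.toAdd j)
  rw [Finset.univ_sum_single, ofAdd_toAdd] at hsum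
  refine hsum.trans (Finset.sum_le_sum fun j _ => ?_)
  rw [ofAdd_single_eq_zpow]
  have hbasis : wordNorm (standardBasis ι) (Multiplicative.ofAdd (Pi.single j 1)) ≤ 1 := by
    simpa using wordNorm_prod_le (w := [Multiplicative.ofAdd (Pi.single j 1 : ι → ℤ)])
      (List.forall_mem_singleton.2 (Or.inl (Set.mem_range_self j)))
  exact (wordNorm_zpow_le closure_standardBasis _ _).trans
    ((Nat.mul_le_mul_right _ hbasis).trans_eq (one_mul _))

theorem sum_natAbs_le_length {w : List (Multiplicative (ι → ℤ))}
    (hw : ∀ x ∈ w, x ∈ standardBasis ι ∨ x⁻¹ ∈ standardBasis ι) :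
    ∑ j, (w.prod.toAdd j).natAbs ≤ w.length := by
  have hbasis {x : Multiplicative (ι → ℤ)} (hx : x ∈ standardBasis ι) :
      ∑ j, (x.toAdd j).natAbs = 1 := by
    obtain ⟨i, rfl⟩ := hx
    rw [Finset.sum_eq_single_of_mem i (Finset.mem_univ i) fun j _ hj => by simp [hj]]
    simp
  induction w with
  | nil => simp
  | cons x w ih =>
    obtain ⟨hx, hw⟩ := List.forall_mem_cons.1 hw
    have hx_sum : ∑ j, (x.toAdd j).natAbs = 1 :=
      hx.elim hbasis fun hx => by simpa using hbasis hx
    calc ∑ j, ((x :: w).prod.toAdd j).natAbs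
        ≤ ∑ j, ((x.toAdd j).natAbs + (w.prod.toAdd j).natAbs) := by
          refine Finset.sum_le_sum fun j _ => ?_
          rw [List.prod_cons]
          exact Int.natAbs_add_le _ _
      _ ≤ (x :: w).length := by
          rw [Finset.sum_add_distrib, hx_sum, List.length_cons, add_comm]
          exact Nat.add_le_add_right (ih hw) 1

theorem wordNorm_standardBasis (x : Multiplicative (ι → ℤ)) :
    wordNorm (standardBasis ι) x = ∑ j, (x.toAdd j).natAbs := by
  refine (wordNorm_standardBasis_le x).antisymm ?_
  obtain ⟨w, hw, rfl, hlen⟩ := exists_word closure_standardBasis x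
  exact hlen ▸ sum_natAbs_le_length hw

theorem wordNorm_map_mulEquiv {G H : Type*} [Group G] [Group H] (e : G ≃* H) {S : Set G}
    (hS : Subgroup.closure S = ⊤) (g : G) : wordNorm (e '' S) (e g) = wordNorm S g := by
  refine (wordNorm_map_le hS e.toMonoidHom g).antisymm ?_
  have hle := wordNorm_map_le (closure_image_eq_top hS (f := e.toMonoidHom) e.surjective)
    e.symm.toMonoidHom (e g)
  simpa [Set.image_image] using hle

end FreeAbelian

theorem isUnconstrictedGroup_of_mulEquiv {ι : Type*} [Finite ι] [Nontrivial ι] {H : Type*} [Group H]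
    (e : H ≃* Multiplicative (ι → ℤ)) : IsUnconstrictedGroup H := by
  classical
  have := Fintype.ofFinite ι
  have htop : Subgroup.closure (e.symm '' standardBasis ι) = ⊤ :=
    closure_image_eq_top closure_standardBasis (f := e.symm.toMonoidHom) e.symm.surjective
  refine ⟨e.symm '' standardBasis ι, htop, (Set.finite_range _).image _, ?_⟩
  let := wordMetricSpace _ htop
  have hc : IsLatticeChart (e.toEquiv.trans Multiplicative.toAdd) := by
    intro x y
    change (wordNorm (e.symm '' standardBasis ι) (x⁻¹ * y) : ℝ) = _
    rw [← e.symm_apply_apply (x⁻¹ * y), wordNorm_map_mulEquiv e.symm closure_standardBasis,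
      wordNorm_standardBasis, Nat.cast_sum]
    refine Finset.sum_congr rfl fun j _ => ?_
    rw [Nat.cast_natAbs, abs_sub_comm]
    simp [neg_add_eq_sub]
  exact ⟨hc.hasConesWithoutCutPoints, hc.nearBiinfiniteGeodesics⟩

/-! ### Commuting elementary moves -/

section CommutingMoves

open FreeGroup (mk)

theorem mulAut_zpow_apply_eq_self {G : Type*} [Group G] {τ : MulAut G} {h : G} (hh : τ h = h)
    (k : ℤ) : (τ ^ k) h = h :=
  (MulAction.stabilizer (MulAut G) h).zpow_mem hh k

theorem mulAut_zpow_apply_eq_mul_zpow {G : Type*} [Group G] {τ : MulAut G} {g h : G}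
    (hg : τ g = g * h) (hh : τ h = h) (k : ℤ) : (τ ^ k) g = g * h ^ k := by
  induction k with
  | zero => simp
  | succ k ih =>
    rw [zpow_add_one, MulAut.mul_apply, hg, map_mul, ih, mulAut_zpow_apply_eq_self hh,
      zpow_add_one, mul_assoc]
  | pred k ih =>
    have hinv : τ⁻¹ g = g * h⁻¹ := by
      rw [MulAut.inv_apply, MulEquiv.symm_apply_eq, map_mul, map_inv, hg, hh, mul_inv_cancel_right]
    rw [zpow_sub_one, MulAut.mul_apply, hinv, map_mul, map_inv, ih, mulAut_zpow_apply_eq_self hh,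
      zpow_sub_one, mul_assoc]

variable {α : Type*} {φ ψ : MulAut (FreeGroup α)} {a b s t : α × Bool}

theorem mulAut_eq_of_apply_letter (h : ∀ i, ∃ l : α × Bool, l.1 = i ∧ φ (mk [l]) = ψ (mk [l])) :
    φ = ψ := by
  refine MulEquiv.toMonoidHom_injective (FreeGroup.ext_hom _ _ fun i => ?_)
  obtain ⟨l, rfl, hl⟩ := h i
  rcases mk_singleton_eq_or l with hl' | hl' <;> rw [hl'] at hl
  · exact hl
  · rwa [map_inv, map_inv, inv_inj] at hl

namespace IsElementaryMove

theorem zpow_apply_letter_of_ne {l : α × Bool} (h : IsElementaryMove φ a s) (hl : l.1 ≠ a.1)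
    (k : ℤ) : (φ ^ k) (mk [l]) = mk [l] :=
  mulAut_zpow_apply_eq_self (h.apply_letter_of_ne hl) k

theorem zpow_apply_invLetter (h : IsElementaryMove φ a s) (hs : s.1 ≠ a.1) (k : ℤ) :
    (φ ^ k) (mk [invLetter a]) = mk [invLetter a] * mk [s] ^ k :=
  mulAut_zpow_apply_eq_mul_zpow h.apply_invLetter (h.apply_letter_of_ne hs) k

theorem zpow_apply_letter (h : IsElementaryMove φ a s) (hs : s.1 ≠ a.1) (k : ℤ) :
    (φ ^ k) (mk [a]) = (mk [s] ^ k)⁻¹ * mk [a] := by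
  rw [← inv_inj, ← map_inv, ← mk_invLetter, h.zpow_apply_invLetter hs, mul_inv_rev, inv_inv,
    mk_invLetter]

theorem commute (hφ : IsElementaryMove φ a s) (hψ : IsElementaryMove ψ b t) (hab : a ≠ b)
    (hsb : s.1 ≠ b.1) (hta : t.1 ≠ a.1) : Commute φ ψ := by
  refine mulAut_eq_of_apply_letter fun i => ?_
  simp only [MulAut.mul_apply]
  by_cases hia : i = a.1
  · refine ⟨invLetter a, hia.symm, ?_⟩
    by_cases hfst : b.1 = a.1
    · obtain rfl := (eq_or_eq_invLetter hfst).resolve_left hab.symm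
      rw [hψ.1, hφ.apply_invLetter, map_mul, map_mul, map_inv, hφ.apply_invLetter, hψ.1,
        hφ.apply_letter_of_ne hta, hψ.apply_letter_of_ne hsb, mul_assoc]
    · have hψ_a : ψ (mk [invLetter a]) = mk [invLetter a] :=
        hψ.apply_letter_of_ne (Ne.symm hfst)
      rw [hψ_a, hφ.apply_invLetter, map_mul, hψ_a, hψ.apply_letter_of_ne hsb]
  by_cases hib : i = b.1
  · have hφ_b : φ (mk [invLetter b]) = mk [invLetter b] :=
      hφ.apply_letter_of_ne fun h => hia (hib.trans h)
    refine ⟨invLetter b, hib.symm, ?_⟩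
    rw [hφ_b, hψ.apply_invLetter, map_mul, hφ_b, hφ.apply_letter_of_ne hta]
  · refine ⟨(i, true), rfl, ?_⟩
    rw [hφ.apply_letter_of_ne (l := (i, true)) hia, hψ.apply_letter_of_ne (l := (i, true)) hib,
      hφ.apply_letter_of_ne (l := (i, true)) hia]

theorem zpow_mul_zpow_apply_invLetter (hφ : IsElementaryMove φ a s)
    (hψ : IsElementaryMove ψ (invLetter a) t) (hsa : s.1 ≠ a.1) (hta : t.1 ≠ a.1) (i j : ℤ) :
    (φ ^ i * ψ ^ j) (mk [invLetter a]) = (mk [t] ^ j)⁻¹ * (mk [invLetter a] * mk [s] ^ i) := by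
  rw [MulAut.mul_apply, hψ.zpow_apply_letter hta, map_mul, map_inv, map_zpow,
    hφ.zpow_apply_letter_of_ne hta, hφ.zpow_apply_invLetter hsa]

end IsElementaryMove

end CommutingMoves

section PowersInWords

open FreeGroup (mk)

variable {α : Type*} {x y s t : α × Bool}

theorem exists_mk_singleton_zpow_eq (s : α × Bool) (k : ℤ) :
    ∃ s' : α × Bool, s'.1 = s.1 ∧ mk [s] ^ k = mk (List.replicate k.natAbs s') := by
  obtain ⟨m, rfl | rfl⟩ := k.eq_nat_or_neg
  · exact ⟨s, rfl, by simp [FreeGroup.pow_mk]⟩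
  · refine ⟨invLetter s, rfl, ?_⟩
    rw [zpow_neg, ← inv_zpow, ← mk_invLetter]
    simp [FreeGroup.pow_mk]

theorem isReduced_replicate (m : ℕ) (s : α × Bool) : FreeGroup.IsReduced (List.replicate m s) :=
  List.isChain_replicate_of_rel m fun _ => rfl

theorem isCyclicallyReduced_of_three (hxs : x.1 ≠ s.1) (hxt : x.1 ≠ t.1) (hst : s.1 ≠ t.1)
    (m k : ℕ) :
    FreeGroup.IsCyclicallyReduced ([x] ++ List.replicate m s ++ List.replicate k t) := by
  simp only [FreeGroup.isCyclicallyReduced_iff, isReduced_append_iff, isReduced_replicate]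
  rcases m with _ | m <;> rcases k with _ | k <;>
    simp [← fst_eq_imp_snd_eq_iff, hxs, hxt, hst, hxs.symm, hxt.symm,
      List.getLast?_replicate, List.head?_replicate, List.getLast?_append, List.getLast?_cons]

theorem isCyclicallyReduced_of_four (hxs : x.1 ≠ s.1) (hxt : x.1 ≠ t.1) (hys : y.1 ≠ s.1)
    (hyt : y.1 ≠ t.1) (hxy : x.1 ≠ y.1) (m k : ℕ) :
    FreeGroup.IsCyclicallyReduced
      ([x] ++ List.replicate m s ++ [y] ++ List.replicate k t) := by
  simp only [FreeGroup.isCyclicallyReduced_iff, isReduced_append_iff, isReduced_replicate]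
  rcases m with _ | m <;> rcases k with _ | k <;>
    simp [← fst_eq_imp_snd_eq_iff, hxs, hyt, hxy, hxt.symm, hys.symm, hxy.symm,
      List.getLast?_replicate, List.head?_replicate, List.getLast?_append, List.getLast?_cons]

variable [DecidableEq α]

theorem hasPower_conj_of_three (hxs : x.1 ≠ s.1) (hxt : x.1 ≠ t.1) (hst : s.1 ≠ t.1) (i j : ℤ)
    (g : FreeGroup α) :
    HasPower (g * (mk [x] * mk [s] ^ i * mk [t] ^ j) * g⁻¹) (max i.natAbs j.natAbs / 2) := by
  obtain ⟨s', hs', hs_pow⟩ := exists_mk_singleton_zpow_eq s i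
  obtain ⟨t', ht', ht_pow⟩ := exists_mk_singleton_zpow_eq t j
  rw [← hs'] at hxs hst
  rw [← ht'] at hxt hst
  have hW := isCyclicallyReduced_of_three hxs hxt hst i.natAbs j.natAbs
  rw [hs_pow, ht_pow, FreeGroup.mul_mk, FreeGroup.mul_mk]
  rcases max_choice i.natAbs j.natAbs with h | h <;> rw [h]
  · exact hasPower_conj hW (by simp) (List.infix_append _ _ _) g
  · exact hasPower_conj hW (by simp) (List.suffix_append _ _).isInfix g

theorem hasPower_conj_of_four (hxs : x.1 ≠ s.1) (hxt : x.1 ≠ t.1) (hys : y.1 ≠ s.1)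
    (hyt : y.1 ≠ t.1) (hxy : x.1 ≠ y.1) (i j : ℤ) (g : FreeGroup α) :
    HasPower (g * (mk [x] * mk [s] ^ i * mk [y] * mk [t] ^ j) * g⁻¹)
      (max i.natAbs j.natAbs / 2) := by
  obtain ⟨s', hs', hs_pow⟩ := exists_mk_singleton_zpow_eq s i
  obtain ⟨t', ht', ht_pow⟩ := exists_mk_singleton_zpow_eq t j
  rw [← hs'] at hxs hys
  rw [← ht'] at hxt hyt
  have hW := isCyclicallyReduced_of_four hxs hxt hys hyt hxy i.natAbs j.natAbs
  rw [hs_pow, ht_pow, FreeGroup.mul_mk, FreeGroup.mul_mk, FreeGroup.mul_mk]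
  rcases max_choice i.natAbs j.natAbs with h | h <;> rw [h]
  · have hinfix := List.infix_append [x] (List.replicate i.natAbs s') [y]
    exact hasPower_conj hW (by simp) (hinfix.trans (List.prefix_append _ _).isInfix) g
  · exact hasPower_conj hW (by simp) (List.suffix_append _ _).isInfix g

end PowersInWords

/-- Commuting automorphisms whose classes form an undistorted pair in the outer automorphism group,
hence also in the automorphism group, by `IsUndistortedPair.of_map`. -/
structure IsOuterUndistortedPair {G : Type*} [Group G] (φ ψ : MulAut G) : Prop where
  commute : Commute φ ψ
  isUndistortedPair_out : IsUndistortedPair (φ : Out G) (ψ : Out G)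

theorem IsOuterUndistortedPair.isUndistortedPair {G : Type*} [Group G] {φ ψ : MulAut G}
    (h : IsOuterUndistortedPair φ ψ) : IsUndistortedPair φ ψ :=
  .of_map (QuotientGroup.mk'_surjective (Inn G)) h.commute h.isUndistortedPair_out

section UndistortedMoves

open FreeGroup (mk)

variable {α : Type*} [Finite α] {φ ψ : MulAut (FreeGroup α)} {a b s t : α × Bool}

theorem isOuterUndistortedPair_of_hasPower [DecidableEq α] (hc : Commute φ ψ) (w : FreeGroup α)
    (h : ∀ (i j : ℤ) (g : FreeGroup α),
      HasPower (g * (φ ^ i * ψ ^ j) w * g⁻¹) (max i.natAbs j.natAbs / 2)) :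
    IsOuterUndistortedPair φ ψ := by
  refine ⟨hc, hc.map (QuotientGroup.mk' _), fun S hS hS_top => ?_⟩
  obtain ⟨B, hB⟩ := exists_le_wordNorm_add_norm hS hS_top
  refine ⟨4 * (B + w.norm + 1), fun i j => ?_⟩
  have hle := hB _ w _ (h i j)
  rw [QuotientGroup.mk_mul, QuotientGroup.mk_zpow, QuotientGroup.mk_zpow] at hle
  set N := wordNorm S ((φ : Out (FreeGroup α)) ^ i * (ψ : Out (FreeGroup α)) ^ j)
  calc i.natAbs + j.natAbs ≤ 4 * (B * N + w.norm + 1) := by lia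
    _ ≤ 4 * ((B + w.norm + 1) * (N + 1)) := by gcongr; nlinarith
    _ = 4 * (B + w.norm + 1) * (N + 1) := by ring

namespace IsElementaryMove

theorem isOuterUndistortedPair (hφ : IsElementaryMove φ a s) (hψ : IsElementaryMove ψ b t)
    (hab : a.1 ≠ b.1) (hsa : s.1 ≠ a.1) (hsb : s.1 ≠ b.1) (hta : t.1 ≠ a.1) (htb : t.1 ≠ b.1) :
    IsOuterUndistortedPair φ ψ := by
  classical
  refine isOuterUndistortedPair_of_hasPower (hφ.commute hψ (ne_of_apply_ne _ hab) hsb hta)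
    (mk [invLetter a] * mk [invLetter b]) fun i j g => ?_
  have himage : (φ ^ i * ψ ^ j) (mk [invLetter a] * mk [invLetter b]) =
      mk [invLetter a] * mk [s] ^ i * mk [invLetter b] * mk [t] ^ j := by
    rw [MulAut.mul_apply, map_mul, hψ.zpow_apply_letter_of_ne (l := invLetter a) hab,
      hψ.zpow_apply_invLetter htb, map_mul, map_mul, map_zpow,
      hφ.zpow_apply_letter_of_ne (l := invLetter b) hab.symm, hφ.zpow_apply_letter_of_ne hta,
      hφ.zpow_apply_invLetter hsa, mul_assoc _ (mk [invLetter b])]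
  rw [himage]
  exact hasPower_conj_of_four (x := invLetter a) (y := invLetter b) hsa.symm hta.symm hsb.symm
    htb.symm hab i j g

theorem isOuterUndistortedPair_invLetter_of_ne (hφ : IsElementaryMove φ a s)
    (hψ : IsElementaryMove ψ (invLetter a) t) (hsa : s.1 ≠ a.1) (hta : t.1 ≠ a.1)
    (hst : s.1 ≠ t.1) :
    IsOuterUndistortedPair φ ψ := by
  classical
  refine isOuterUndistortedPair_of_hasPower (hφ.commute hψ (invLetter_ne a).symm hsa hta)
    (mk [invLetter a]) fun i j g => ?_
  rw [zpow_mul_zpow_apply_invLetter hφ hψ hsa hta]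
  have hpower := hasPower_conj_of_three (x := invLetter a) hsa.symm hta.symm hst i (-j)
    (g * (mk [t] ^ j)⁻¹)
  rw [Int.natAbs_neg] at hpower
  convert hpower using 1
  group

theorem isOuterUndistortedPair_invLetter_of_exists_ne (hφ : IsElementaryMove φ a s)
    (hψ : IsElementaryMove ψ (invLetter a) t) (hsa : s.1 ≠ a.1) (hta : t.1 ≠ a.1)
    (hy : ∃ y, y ≠ a.1 ∧ y ≠ s.1 ∧ y ≠ t.1) :
    IsOuterUndistortedPair φ ψ := by
  classical
  obtain ⟨y, hya, hys, hyt⟩ := hy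
  refine isOuterUndistortedPair_of_hasPower (hφ.commute hψ (invLetter_ne a).symm hsa hta)
    (mk [invLetter a] * mk [(y, true)]) fun i j g => ?_
  have hy_fixed : (φ ^ i * ψ ^ j) (mk [(y, true)]) = mk [(y, true)] := by
    rw [MulAut.mul_apply, hψ.zpow_apply_letter_of_ne (l := (y, true)) hya,
      hφ.zpow_apply_letter_of_ne (l := (y, true)) hya]
  rw [map_mul, hy_fixed, zpow_mul_zpow_apply_invLetter hφ hψ hsa hta]
  have hpower := hasPower_conj_of_four (x := invLetter a) (y := (y, true)) hsa.symm hta.symm hys hyt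
    hya.symm i (-j) (g * (mk [t] ^ j)⁻¹)
  rw [Int.natAbs_neg] at hpower
  convert hpower using 1
  group

end IsElementaryMove

end UndistortedMoves

/-! ### Networks of undistorted pairs -/

section FiniteIndex

variable {G : Type*} [Group G] {K : Subgroup G}

theorem finiteIndex_of_forall_exists_mul {W : Set G} (hW : W.Finite)
    (h : ∀ g : G, ∃ τ ∈ K, ∃ σ ∈ W, g = τ * σ) : K.FiniteIndex := by
  have hsurj : (fun σ => (QuotientGroup.mk σ⁻¹ : G ⧸ K)) '' W = Set.univ := by
    refine Set.eq_univ_of_forall fun q => ?_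
    obtain ⟨g, rfl⟩ := QuotientGroup.mk_surjective q
    obtain ⟨τ, hτ, σ, hσ, hg⟩ := h g⁻¹
    refine ⟨σ, hσ, QuotientGroup.eq.2 ?_⟩
    rw [← inv_inv g, hg]
    simpa using K.inv_mem hτ
  have : Finite (G ⧸ K) := Set.finite_univ_iff.1 (hsurj ▸ hW.image _)
  exact Subgroup.finiteIndex_of_finite_quotient

theorem fg_of_finiteIndex_closure {T : Set G} (hT : T.Finite) [(Subgroup.closure T).FiniteIndex] :
    Group.FG G := by
  refine Group.fg_iff.2 ⟨T ∪ Set.range fun q : G ⧸ Subgroup.closure T => q.out, ?_,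
    hT.union (Set.finite_range _)⟩
  refine eq_top_iff.2 fun g _ => ?_
  obtain ⟨h, hh⟩ := QuotientGroup.mk_out_eq_mul (Subgroup.closure T) g
  rw [eq_mul_inv_of_mul_eq hh.symm]
  exact mul_mem (Subgroup.subset_closure (Or.inr ⟨_, rfl⟩))
    (inv_mem (Subgroup.closure_mono Set.subset_union_left h.2))

theorem exists_forall_exists_wordNorm_le [K.FiniteIndex] (S : Set G) :
    ∃ C : ℕ, ∀ g : G, ∃ h ∈ K, wordNorm S (g⁻¹ * h) ≤ C := by
  obtain ⟨C, hC⟩ := (Set.finite_range fun q : G ⧸ K => wordNorm S q.out).bddAbove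
  refine ⟨C, fun g => ?_⟩
  obtain ⟨h, hh⟩ := QuotientGroup.mk_out_eq_mul K g⁻¹
  exact ⟨h, h.2, hh ▸ hC ⟨_, rfl⟩⟩

end FiniteIndex

section PairNetwork

variable {G H : Type*} [Group G] [Group H]

/-- The set of the two components of a pair. -/
def pairMembers {α : Type*} (p : α × α) : Set α := {p.1, p.2}

theorem image_pairMembers {α β : Type*} (f : α → β) (p : α × α) :
    f '' pairMembers p = pairMembers (Prod.map f f p) :=
  Set.image_pair f p.1 p.2

/-- `p` and `q` are consecutive members of a chain in `P`: they belong to `P` and have a common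
component. -/
def IsPairChainStep {α : Type*} (P : Set (α × α)) (p q : α × α) : Prop :=
  p ∈ P ∧ q ∈ P ∧ (pairMembers p ∩ pairMembers q).Nonempty

/-- The subgroup generated by the components of `p`. -/
def pairSubgroup (p : G × G) : Subgroup G := Subgroup.closure (pairMembers p)

theorem map_pairSubgroup (f : G →* H) (p : G × G) :
    (pairSubgroup p).map f = pairSubgroup (Prod.map f f p) := by
  rw [pairSubgroup, pairSubgroup, MonoidHom.map_closure, image_pairMembers]

theorem IsUndistortedPair.infinite_inf_pairSubgroup [Group.FG G] {p q : G × G}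
    (hp : IsUndistortedPair p.1 p.2) (hpq : (pairMembers p ∩ pairMembers q).Nonempty) :
    ((pairSubgroup p ⊓ pairSubgroup q : Subgroup G) : Set G).Infinite := by
  obtain ⟨x, hxp, hxq⟩ := hpq
  have hx : (Subgroup.zpowers x : Set G).Infinite := by
    rcases hxp with rfl | rfl
    exacts [hp.infinite_zpowers, hp.symm.infinite_zpowers]
  refine hx.mono (SetLike.coe_subset_coe.2 (Subgroup.zpowers_le.2 ?_))
  exact ⟨Subgroup.subset_closure hxp, Subgroup.subset_closure hxq⟩

/-- A finite set of pairs whose components generate a subgroup of finite index and whose subgroups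
`pairSubgroup p` are undistorted free abelian of rank two and linked by common components. It makes
a group algebraically thick of order at most one. -/
structure IsPairNetwork (P : Set (G × G)) : Prop where
  finite : P.Finite
  nonempty : P.Nonempty
  isUndistortedPair : ∀ p ∈ P, IsUndistortedPair p.1 p.2
  connected : ∀ p ∈ P, ∀ q ∈ P, Relation.ReflTransGen (IsPairChainStep P) p q
  finiteIndex : (Subgroup.closure (⋃ p ∈ P, pairMembers p)).FiniteIndex

namespace IsPairNetwork

variable {P : Set (G × G)}

theorem finite_biUnion_pairMembers (hP : IsPairNetwork P) : (⋃ p ∈ P, pairMembers p).Finite :=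
  hP.finite.biUnion fun _ _ => Set.toFinite {_, _}

theorem groupFG (hP : IsPairNetwork P) : Group.FG G :=
  have := hP.finiteIndex
  fg_of_finiteIndex_closure hP.finite_biUnion_pairMembers

theorem nonempty_mulEquiv (hP : IsPairNetwork P) :
    ∀ K ∈ pairSubgroup '' P, Nonempty (K ≃* Multiplicative (ℤ × ℤ)) := by
  rintro _ ⟨p, hp, rfl⟩
  have := hP.groupFG
  exact (hP.isUndistortedPair p hp).nonempty_mulEquiv

theorem exists_isAlgebraicNetwork (hP : IsPairNetwork P) {S : Set G} (hS : S.Finite)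
    (hS_top : Subgroup.closure S = ⊤) :
    ∃ M : ℝ, 0 < M ∧ IsAlgebraicNetwork S M (pairSubgroup '' P) := by
  have := hP.groupFG
  have := hP.finiteIndex
  obtain ⟨C, hC⟩ :=
    exists_forall_exists_wordNorm_le (K := Subgroup.closure (⋃ p ∈ P, pairMembers p)) S
  refine ⟨C + 1, by positivity, hS, hS_top, by positivity, hP.finite.image _,
    hP.nonempty.image _, ?undistorted, ⟨_, hP.finiteIndex, fun g => ?dense, _,
    hP.finite_biUnion_pairMembers, rfl, ?subset⟩, ?connected⟩
  case undistorted =>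
    rintro _ ⟨p, hp, rfl⟩
    exact ⟨(Subgroup.fg_iff _).2 ⟨_, rfl, Set.toFinite {_, _}⟩,
      (hP.isUndistortedPair p hp).isUndistorted⟩
  case dense =>
    obtain ⟨h, hh, hle⟩ := hC g
    exact ⟨h, hh, by exact_mod_cast Nat.lt_succ_of_le hle⟩
  case subset =>
    rw [Set.biUnion_image]
    exact Set.iUnion₂_mono fun p _ => Subgroup.subset_closure
  case connected =>
    rintro _ ⟨p, hp, rfl⟩ _ ⟨q, hq, rfl⟩
    refine Relation.ReflTransGen.lift pairSubgroup ?_ _ _ (hP.connected p hp q hq)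
    rintro a b ⟨ha, hb, hab⟩
    exact ⟨⟨a, ha, rfl⟩, ⟨b, hb, rfl⟩, (hP.isUndistortedPair a ha).infinite_inf_pairSubgroup hab⟩

theorem exists_algThickSuccWithRespectTo (hP : IsPairNetwork P) (S : Set G) (hS : S.Finite)
    (hS_top : Subgroup.closure S = ⊤) :
    ∃ M : ℝ, 0 < M ∧ AlgThickSuccWithRespectTo 0 S M (pairSubgroup '' P) := by
  obtain ⟨M, hM, hnet⟩ := hP.exists_isAlgebraicNetwork hS hS_top
  refine ⟨M, hM, hnet, fun K hK => ?_⟩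
  obtain ⟨e⟩ := hP.nonempty_mulEquiv K hK
  exact isUnconstrictedGroup_of_mulEquiv
    (e.trans (RingEquiv.piFinTwo fun _ => ℤ).symm.toAddEquiv.toMultiplicative)

theorem algThickOfOrderAtMost_one (hP : IsPairNetwork P) : AlgThickOfOrderAtMost 1 G := by
  obtain ⟨S, hS_top, hS⟩ := Group.fg_iff.1 hP.groupFG
  obtain ⟨M, -, hM⟩ := hP.exists_algThickSuccWithRespectTo S hS hS_top
  exact ⟨S, M, pairSubgroup '' P, hM⟩

theorem map (hP : IsPairNetwork P) {f : G →* H} (hf : Function.Surjective f)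
    (hfP : ∀ p ∈ P, IsUndistortedPair (f p.1) (f p.2)) : IsPairNetwork (Prod.map f f '' P) where
  finite := hP.finite.image _
  nonempty := hP.nonempty.image _
  isUndistortedPair := Set.forall_mem_image.2 hfP
  connected := by
    rintro _ ⟨p, hp, rfl⟩ _ ⟨q, hq, rfl⟩
    refine Relation.ReflTransGen.lift (Prod.map f f) ?_ _ _ (hP.connected p hp q hq)
    rintro a b ⟨ha, hb, x, hxa, hxb⟩
    refine ⟨⟨a, ha, rfl⟩, ⟨b, hb, rfl⟩, f x, ?_⟩
    simp only [← image_pairMembers]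
    exact ⟨Set.mem_image_of_mem f hxa, Set.mem_image_of_mem f hxb⟩
  finiteIndex := by
    have hclosure : (Subgroup.closure (⋃ p ∈ P, pairMembers p)).map f =
        Subgroup.closure (⋃ q ∈ Prod.map f f '' P, pairMembers q) := by
      simp only [MonoidHom.map_closure, Set.image_iUnion₂, image_pairMembers, Set.biUnion_image]
    rw [← hclosure]
    exact ⟨ne_zero_of_dvd_ne_zero hP.finiteIndex.index_ne_zero (Subgroup.index_map_dvd _ hf)⟩

end IsPairNetwork

end PairNetwork

/-! ### Transvections as elementary moves -/

section Transvections

open FreeGroup (mk of)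

variable {α : Type*} {τ φ ψ : MulAut (FreeGroup α)} {a v s : α × Bool}

theorem isElementaryMove_of_apply_letter (ha : τ (mk [a]) = (mk [v])⁻¹ * mk [a])
    (hfix : ∀ i, i ≠ a.1 → ∃ l : α × Bool, l.1 = i ∧ τ (mk [l]) = mk [l]) :
    IsElementaryMove τ a v := by
  refine ⟨ha, fun i hi => ?_⟩
  obtain ⟨l, rfl, hl⟩ := hfix i hi
  rcases mk_singleton_eq_or l with hl' | hl' <;> rw [hl'] at hl
  · exact hl
  · rwa [map_inv, inv_inj] at hl

theorem IsElementaryMove.inv (h : IsElementaryMove τ a v) (hva : v.1 ≠ a.1) :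
    IsElementaryMove τ⁻¹ a (invLetter v) := by
  refine ⟨?_, fun i hi => (MulEquiv.symm_apply_eq τ).2 (h.2 i hi).symm⟩
  rw [mk_invLetter]
  simpa only [zpow_neg, zpow_one] using h.zpow_apply_letter hva (-1)

theorem IsElementaryMove.commutator (hφ : IsElementaryMove φ a v)
    (hψ : IsElementaryMove ψ (invLetter v) s) (hva : v.1 ≠ a.1) (hsv : s.1 ≠ v.1)
    (hsa : s.1 ≠ a.1) : IsElementaryMove (φ⁻¹ * ψ * φ * ψ⁻¹) a s := by
  have hφ' := hφ.inv hva
  have hψ' := hψ.inv hsv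
  refine isElementaryMove_of_apply_letter ?_ fun i hi => ?_
  · have hψv : ψ (mk [v]) = mk [v] * mk [s] := by
      simpa only [invLetter_invLetter] using hψ.apply_invLetter
    simp only [MulAut.mul_apply]
    rw [hψ'.apply_letter_of_ne hva.symm, hφ.1, map_mul, map_inv, hψv,
      hψ.apply_letter_of_ne (l := a) hva.symm, map_mul, map_inv, map_mul,
      hφ'.apply_letter_of_ne hva, hφ'.apply_letter_of_ne hsa, hφ'.1, mk_invLetter]
    group
  by_cases hiv : i = v.1
  · have hψv : ψ⁻¹ (mk [v]) = mk [v] * mk [invLetter s] := by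
      simpa only [invLetter_invLetter] using hψ'.apply_invLetter
    have hφψv : φ (ψ⁻¹ (mk [v])) = ψ⁻¹ (mk [v]) := by
      rw [hψv, map_mul, hφ.apply_letter_of_ne hva, hφ.apply_letter_of_ne (l := invLetter s) hsa]
    refine ⟨v, hiv.symm, ?_⟩
    rw [MulAut.mul_apply, MulAut.mul_apply, hφψv, MulAut.mul_apply, MulAut.apply_inv_self,
      hφ'.apply_letter_of_ne hva]
  · exact ⟨(i, true), rfl, by
      simp only [MulAut.mul_apply]
      rw [hψ'.apply_letter_of_ne (l := (i, true)) hiv, hφ.apply_letter_of_ne (l := (i, true)) hi,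
        hψ.apply_letter_of_ne (l := (i, true)) hiv, hφ'.apply_letter_of_ne (l := (i, true)) hi]⟩

variable [DecidableEq α] {i j : α}

theorem isElementaryMove_rightTransvection (h : j ≠ i) :
    IsElementaryMove (rightTransvection i j h) (i, false) (j, true) := by
  refine ⟨?_, fun k hk => transvectionHom_of_ne hk _ _⟩
  have hi : rightTransvection i j h (of i) = of i * of j := by
    simpa using! transvectionHom_of_self i 1 (of j)
  rw [← inv_inj, ← map_inv]
  simpa using! hi

theorem isElementaryMove_leftTransvection (h : j ≠ i) :
    IsElementaryMove (leftTransvection i j h) (i, true) (j, false) := by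
  refine ⟨?_, fun k hk => transvectionHom_of_ne hk _ _⟩
  have hi : leftTransvection i j h (of i) = of j * of i := by
    simpa using! transvectionHom_of_self i (of j) 1
  simpa using! hi

end Transvections

/-! ### The pairs of Nielsen transvections -/

section NielsenMoves

variable {n : ℕ} (hn : 3 ≤ n)

theorem isElementaryMove_nielsenR (i : ZMod n) :
    IsElementaryMove (nielsenR hn i) (i + 1, false) (i, true) :=
  isElementaryMove_rightTransvection _

theorem isElementaryMove_nielsenL (i : ZMod n) :
    IsElementaryMove (nielsenL hn i) (i + 1, true) (i, false) :=
  isElementaryMove_leftTransvection _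

theorem isElementaryMove_nielsenN (i : ZMod n) :
    IsElementaryMove (nielsenN hn i) (i + 2, false) (i, true) :=
  isElementaryMove_rightTransvection _

theorem add_natCast_ne_self {k : ℕ} (hk : 0 < k) (hkn : k < n) (i : ZMod n) : i + k ≠ i := by
  rw [Ne, add_eq_left, ZMod.natCast_eq_zero_iff]
  exact Nat.not_dvd_of_pos_of_lt hk hkn

variable {hn} {K : Subgroup (MulAut (FreeGrp n))}

theorem exists_isElementaryMove_add_natCast (hR : ∀ i, nielsenR hn i ∈ K)
    (hL : ∀ i, nielsenL hn i ∈ K) (i : ZMod n) (ε : Bool) {k : ℕ} (hk : 1 ≤ k) (hkn : k < n) :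
    ∃ τ ∈ K, IsElementaryMove τ (i + k, ε) (i, !ε) := by
  have hone (i : ZMod n) : ∃ τ ∈ K, IsElementaryMove τ (i + 1, ε) (i, !ε) := by
    cases ε
    exacts [⟨_, hR i, isElementaryMove_nielsenR hn i⟩, ⟨_, hL i, isElementaryMove_nielsenL hn i⟩]
  induction k, hk using Nat.le_induction with
  | base => simpa only [Nat.cast_one] using hone i
  | succ k hk ih =>
    obtain ⟨ψ, hψK, hψ⟩ := ih (by lia)
    obtain ⟨φ, hφK, hφ⟩ := hone (i + k)
    have hi : i ≠ i + k := (add_natCast_ne_self hk (by lia) i).symm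
    have hi' : i ≠ i + k + 1 := by
      simpa only [Nat.cast_succ, add_assoc] using (add_natCast_ne_self k.succ_pos hkn i).symm
    rw [Nat.cast_succ, ← add_assoc]
    refine ⟨φ⁻¹ * ψ * φ * ψ⁻¹, K.mul_mem (K.mul_mem (K.mul_mem (K.inv_mem hφK) hψK) hφK)
      (K.inv_mem hψK), hφ.commutator ?_ (ne_add_one_zmod hn _) hi hi'⟩
    simpa only [invLetter, Bool.not_not] using hψ

theorem exists_isElementaryMove (hR : ∀ i, nielsenR hn i ∈ K) (hL : ∀ i, nielsenL hn i ∈ K)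
    (a v : ZMod n × Bool) (hav : a.1 ≠ v.1) : ∃ τ ∈ K, IsElementaryMove τ a v := by
  have : NeZero n := ⟨by lia⟩
  have hpos : 1 ≤ (a.1 - v.1).val :=
    Nat.one_le_iff_ne_zero.2 ((ZMod.val_ne_zero _).2 (sub_ne_zero.2 hav))
  obtain ⟨τ, hτK, hτ⟩ := exists_isElementaryMove_add_natCast hR hL v.1 a.2 hpos (ZMod.val_lt _)
  rw [ZMod.natCast_zmod_val, add_sub_cancel] at hτ
  rcases eq_or_eq_invLetter (a := v) (b := (v.1, !a.2)) rfl with hv | hv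
  · exact ⟨τ, hτK, hv ▸ hτ⟩
  · refine ⟨τ⁻¹, K.inv_mem hτK, ?_⟩
    exact hv.symm ▸ hτ.inv hav.symm

theorem finiteIndex_of_nielsen_mem (hR : ∀ i, nielsenR hn i ∈ K) (hL : ∀ i, nielsenL hn i ∈ K) :
    K.FiniteIndex := by
  have : NeZero n := ⟨by lia⟩
  exact finiteIndex_of_forall_exists_mul (finite_signedPerms (ZMod n))
    (exists_mul_mem_signedPerms (exists_isElementaryMove hR hL))

end NielsenMoves

section NielsenPairs

variable {n : ℕ} (hn : 3 ≤ n)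

/-- The pairs of transvections that generate the members of `nielsenFamily`. -/
def nielsenPairs : Set (MulAut (FreeGrp n) × MulAut (FreeGrp n)) :=
  (⋃ (i : ZMod n) (j : ZMod n) (_ : 2 ≤ cyclicDist i j),
    {nielsenR hn i, nielsenL hn i} ×ˢ {nielsenR hn j, nielsenL hn j}) ∪
  Set.range (fun i => (nielsenR hn i, nielsenL hn i)) ∪
  Set.range (fun i => (nielsenN hn i, nielsenR hn i)) ∪
  Set.range (fun i => (nielsenN hn i, nielsenL hn (i + 1)))

theorem finite_nielsenPairs : (nielsenPairs hn).Finite := by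
  have : NeZero n := ⟨by lia⟩
  exact Set.toFinite (_ ∪ _)

theorem image_pairSubgroup_nielsenPairs :
    pairSubgroup '' nielsenPairs hn = nielsenFamily hn := by
  ext H
  simp [nielsenPairs, nielsenFamily, pairSubgroup, pairMembers, Set.image_union,
    Set.image_iUnion, and_assoc, or_assoc, eq_comm (a := H)]

theorem image_pairSubgroup_map_nielsenPairs :
    pairSubgroup '' (Prod.map (QuotientGroup.mk' (Inn (FreeGrp n)))
      (QuotientGroup.mk' (Inn (FreeGrp n))) '' nielsenPairs hn) = outNielsenFamily hn := by
  rw [outNielsenFamily, ← image_pairSubgroup_nielsenPairs, Set.image_image, Set.image_image]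
  simp only [map_pairSubgroup]

theorem exists_isElementaryMove_of_mem {i : ZMod n} {φ : MulAut (FreeGrp n)}
    (hφ : φ ∈ ({nielsenR hn i, nielsenL hn i} : Set (MulAut (FreeGrp n)))) :
    ∃ ε δ : Bool, IsElementaryMove φ (i + 1, ε) (i, δ) := by
  rcases hφ with rfl | rfl
  exacts [⟨_, _, isElementaryMove_nielsenR hn i⟩, ⟨_, _, isElementaryMove_nielsenL hn i⟩]

theorem cyclicDist_comm (i j : ZMod n) : cyclicDist i j = cyclicDist j i := by
  rw [cyclicDist, cyclicDist, ← ZMod.natAbs_valMinAbs_neg, neg_sub]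

include hn in
theorem cyclicDist_add_one_le (i : ZMod n) : cyclicDist (i + 1) i ≤ 1 := by
  have : NeZero n := ⟨by lia⟩
  have : Fact (1 < n) := ⟨by lia⟩
  rw [cyclicDist, add_sub_cancel_left, ZMod.valMinAbs_natAbs_eq_min, ZMod.val_one]
  exact min_le_left _ _

include hn in
theorem ne_add_one_of_two_le_cyclicDist {i j : ZMod n} (hij : 2 ≤ cyclicDist i j) :
    i ≠ j + 1 := by
  rintro rfl
  exact absurd (cyclicDist_add_one_le hn j) (by lia)

theorem isOuterUndistortedPair_of_two_le_cyclicDist {i j : ZMod n} (hij : 2 ≤ cyclicDist i j)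
    {φ ψ : MulAut (FreeGrp n)}
    (hφ : φ ∈ ({nielsenR hn i, nielsenL hn i} : Set (MulAut (FreeGrp n))))
    (hψ : ψ ∈ ({nielsenR hn j, nielsenL hn j} : Set (MulAut (FreeGrp n)))) :
    IsOuterUndistortedPair φ ψ := by
  have : NeZero n := ⟨by lia⟩
  obtain ⟨ε, δ, hφ⟩ := exists_isElementaryMove_of_mem hn hφ
  obtain ⟨ε', δ', hψ⟩ := exists_isElementaryMove_of_mem hn hψ
  have hne : i ≠ j := by
    rintro rfl
    simp [cyclicDist] at hij
  exact hφ.isOuterUndistortedPair hψ (fun h => hne (add_right_cancel h)) (ne_add_one_zmod hn i)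
    (ne_add_one_of_two_le_cyclicDist hn hij)
    (ne_add_one_of_two_le_cyclicDist hn (cyclicDist_comm i j ▸ hij)) (ne_add_one_zmod hn j)

include hn in
theorem add_one_ne_add_two (i : ZMod n) : i + 1 ≠ i + 2 := fun h =>
  ne_add_one_zmod hn (i + 1) (h.trans (by ring))

theorem isOuterUndistortedPair_nielsenR_nielsenL (i : ZMod n) :
    IsOuterUndistortedPair (nielsenR hn i) (nielsenL hn i) := by
  have : NeZero n := ⟨by lia⟩
  exact (isElementaryMove_nielsenR hn i).isOuterUndistortedPair_invLetter_of_exists_ne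
    (isElementaryMove_nielsenL hn i) (ne_add_one_zmod hn i) (ne_add_one_zmod hn i)
    ⟨i + 2, (add_one_ne_add_two hn i).symm, (ne_add_two_zmod hn i).symm,
      (ne_add_two_zmod hn i).symm⟩

theorem isOuterUndistortedPair_nielsenN_nielsenR (i : ZMod n) :
    IsOuterUndistortedPair (nielsenN hn i) (nielsenR hn i) := by
  have : NeZero n := ⟨by lia⟩
  exact (isElementaryMove_nielsenN hn i).isOuterUndistortedPair (isElementaryMove_nielsenR hn i)
    (add_one_ne_add_two hn i).symm (ne_add_two_zmod hn i) (ne_add_one_zmod hn i)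
    (ne_add_two_zmod hn i) (ne_add_one_zmod hn i)

theorem isOuterUndistortedPair_nielsenN_nielsenL (i : ZMod n) :
    IsOuterUndistortedPair (nielsenN hn i) (nielsenL hn (i + 1)) := by
  have : NeZero n := ⟨by lia⟩
  have hL := isElementaryMove_nielsenL hn (i + 1)
  rw [add_assoc, one_add_one_eq_two] at hL
  exact (isElementaryMove_nielsenN hn i).isOuterUndistortedPair_invLetter_of_ne hL
    (ne_add_two_zmod hn i) (add_one_ne_add_two hn i) (ne_add_one_zmod hn i)

theorem isOuterUndistortedPair_of_mem_nielsenPairs :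
    ∀ p ∈ nielsenPairs hn, IsOuterUndistortedPair p.1 p.2 := by
  rintro p (((hp | ⟨i, rfl⟩) | ⟨i, rfl⟩) | ⟨i, rfl⟩)
  · simp only [Set.mem_iUnion] at hp
    obtain ⟨i, j, hij, hφ, hψ⟩ := hp
    exact isOuterUndistortedPair_of_two_le_cyclicDist hn hij hφ hψ
  · exact isOuterUndistortedPair_nielsenR_nielsenL hn i
  · exact isOuterUndistortedPair_nielsenN_nielsenR hn i
  · exact isOuterUndistortedPair_nielsenN_nielsenL hn i

theorem nielsenRL_mem_nielsenPairs (i : ZMod n) :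
    (nielsenR hn i, nielsenL hn i) ∈ nielsenPairs hn :=
  Or.inl (Or.inl (Or.inr ⟨i, rfl⟩))

theorem exists_inter_pairMembers_nonempty {p : MulAut (FreeGrp n) × MulAut (FreeGrp n)}
    (hp : p ∈ nielsenPairs hn) :
    ∃ i, (pairMembers (nielsenR hn i, nielsenL hn i) ∩ pairMembers p).Nonempty := by
  rcases hp with ((hp | ⟨i, rfl⟩) | ⟨i, rfl⟩) | ⟨i, rfl⟩
  · simp only [Set.mem_iUnion] at hp
    obtain ⟨i, j, -, hφ, -⟩ := hp
    exact ⟨i, p.1, hφ, Or.inl rfl⟩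
  · exact ⟨i, _, Or.inl rfl, Or.inl rfl⟩
  · exact ⟨i, _, Or.inl rfl, Or.inr rfl⟩
  · exact ⟨i + 1, _, Or.inr rfl, Or.inr rfl⟩

theorem reflTransGen_nielsenRL_natCast (k : ℕ) :
    Relation.ReflTransGen (IsPairChainStep (nielsenPairs hn))
      (nielsenR hn 0, nielsenL hn 0) (nielsenR hn k, nielsenL hn k) := by
  induction k with
  | zero => rw [Nat.cast_zero]
  | succ k ih =>
    have hNR : (nielsenN hn k, nielsenR hn k) ∈ nielsenPairs hn := Or.inl (Or.inr ⟨k, rfl⟩)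
    have hNL : (nielsenN hn k, nielsenL hn (k + 1)) ∈ nielsenPairs hn := Or.inr ⟨k, rfl⟩
    rw [Nat.cast_succ]
    exact ((ih.tail ⟨nielsenRL_mem_nielsenPairs hn k, hNR, _, Or.inl rfl, Or.inr rfl⟩).tail
      ⟨hNR, hNL, _, Or.inl rfl, Or.inl rfl⟩).tail
        ⟨hNL, nielsenRL_mem_nielsenPairs hn (k + 1), _, Or.inr rfl, Or.inr rfl⟩

theorem reflTransGen_nielsenPairs {p q : MulAut (FreeGrp n) × MulAut (FreeGrp n)}
    (hp : p ∈ nielsenPairs hn) (hq : q ∈ nielsenPairs hn) :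
    Relation.ReflTransGen (IsPairChainStep (nielsenPairs hn)) p q := by
  have : NeZero n := ⟨by lia⟩
  have : Std.Symm (IsPairChainStep (nielsenPairs hn)) :=
    ⟨fun _ _ h => ⟨h.2.1, h.1, Set.inter_comm _ _ ▸ h.2.2⟩⟩
  have hchain {p} (hp : p ∈ nielsenPairs hn) : Relation.ReflTransGen
      (IsPairChainStep (nielsenPairs hn)) (nielsenR hn 0, nielsenL hn 0) p := by
    obtain ⟨i, hi⟩ := exists_inter_pairMembers_nonempty hn hp
    have hRL := reflTransGen_nielsenRL_natCast hn i.val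
    rw [ZMod.natCast_zmod_val] at hRL
    exact hRL.tail ⟨nielsenRL_mem_nielsenPairs hn i, hp, hi⟩
  exact (Relation.ReflTransGen.stdSymm.symm _ _ (hchain hp)).trans (hchain hq)

theorem isPairNetwork_nielsenPairs : IsPairNetwork (nielsenPairs hn) where
  finite := finite_nielsenPairs hn
  nonempty := ⟨_, nielsenRL_mem_nielsenPairs hn 0⟩
  isUndistortedPair p hp := (isOuterUndistortedPair_of_mem_nielsenPairs hn p hp).isUndistortedPair
  connected _ hp _ hq := reflTransGen_nielsenPairs hn hp hq
  finiteIndex := by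
    have hsub (i : ZMod n) : pairMembers (nielsenR hn i, nielsenL hn i) ⊆
        Subgroup.closure (⋃ p ∈ nielsenPairs hn, pairMembers p) :=
      (Set.subset_biUnion_of_mem (nielsenRL_mem_nielsenPairs hn i)).trans Subgroup.subset_closure
    exact finiteIndex_of_nielsen_mem (hn := hn) (fun i => hsub i (Or.inl rfl))
      fun i => hsub i (Or.inr rfl)

end NielsenPairs

theorem mainTheorem5 (n : ℕ) (hn : 3 ≤ n) :
    -- both groups are algebraically thick of order at most one
    (AlgThickOfOrderAtMost 1 (MulAut (FreeGrp n)) ∧ AlgThickOfOrderAtMost 1 (Out (FreeGrp n))) ∧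
    -- namely with respect to the explicit families, for every choice of the word metric
    (∀ S : Set (MulAut (FreeGrp n)), S.Finite → Subgroup.closure S = ⊤ →
      ∃ M : ℝ, 0 < M ∧ AlgThickSuccWithRespectTo 0 S M (nielsenFamily hn)) ∧
    (∀ S : Set (Out (FreeGrp n)), S.Finite → Subgroup.closure S = ⊤ →
      ∃ M : ℝ, 0 < M ∧ AlgThickSuccWithRespectTo 0 S M (outNielsenFamily hn)) ∧
    -- whose members are free abelian of rank two
    (∀ H ∈ nielsenFamily hn, Nonempty (H ≃* Multiplicative (ℤ × ℤ))) ∧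
    (∀ H ∈ outNielsenFamily hn, Nonempty (H ≃* Multiplicative (ℤ × ℤ))) := by
  have hAut := isPairNetwork_nielsenPairs hn
  have hOut := hAut.map (QuotientGroup.mk'_surjective (Inn (FreeGrp n))) fun p hp =>
    (isOuterUndistortedPair_of_mem_nielsenPairs hn p hp).isUndistortedPair_out
  rw [← image_pairSubgroup_map_nielsenPairs, ← image_pairSubgroup_nielsenPairs]
  exact ⟨⟨hAut.algThickOfOrderAtMost_one, hOut.algThickOfOrderAtMost_one⟩,
    hAut.exists_algThickSuccWithRespectTo, hOut.exists_algThickSuccWithRespectTo,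
    hAut.nonempty_mulEquiv, hOut.nonempty_mulEquiv⟩
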